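/- **Setting.** Let $\mathcal P$ be a set of $d$ orthonormal vectors ("patterns") in $\mathbb R^d$, two of which, $o_1$ and $o_2$, are task-specific, the others task-irrelevant. A sample $(x,y)\sim\mathcal D$ has $n=O(d)$ tokens $x^{(1)},\dots,x^{(n)}\in\mathcal P$ and a label $y\in\{+1,-1\}$; each class has probability at least a positive constant; exactly one token is task-specific, equal to $o_1$ if $y=+1$ and to $o_2$ if $y=-1$; each task-irrelevant pattern appears in $x$ with the same probability in both classes, and with probability $O(1/d)$. The model is an expert-choice mixture of $k$ experts. Expert $s$ has a router $w_s\in\mathbb R^d$, neurons $w^{(s)}_1,\dots,w^{(s)}_m\in\mathbb R^d$ ($m\ge1$) and a fixed head $a^{(s)}\in\{\pm1\}$. It chooses a set $J_s(x)$ of $l$ token positions with the largest routing values $\langle w_s,x^{(j)}\rangle$ (ties broken by any fixed rule), with gating values $G^{(s)}_j(x)=e^{\langle w_s,x^{(j)}\rangle}/\sum_{i\in J_s(x)}e^{\langle w_s,x^{(i)}\rangle}$ for $j\in J_s(x)$ and $0$ otherwise, where $2\le l\le n$ and $l=O(1)$. For a set $R$ of experts the output is $$f_R(x)=\sum_{s\in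 R}a^{(s)}\sum_{j=1}^n G^{(s)}_j(x)\sum_{r=1}^m\max(\langle w^{(s)}_r,x^{(j)}\rangle,0).$$ Let $S_1=\{s:a^{(s)}=+1\}$ and $S_2=\{s:a^{(s)}=-1\}$. From pre-trained weights (iteration $0$), all experts are trained by $T$ steps of SGD on $1-yf(x)$ (the sets $J_s(x)$ being treated as locally constant, and the derivative of ReLU at $0$ as $1$), with fresh i.i.d. batches of $B$ samples from $\mathcal D$ and learning rates $\eta_e$ for neurons and $\eta_r$ for routers. Put $\Delta_s^{(T)}=\|w_s^{(T)}\|-\|w_s^{(0)}\|$. For $i\in\{1,2\}$ let $p_i^{(s,0)}$ be the probability, given that $(x,y)$ is in class $i$ (class $1$: $y=+1$; class $2$: $y=-1$), that the pre-trained expert $s$ chooses the token equal to $o_i$ with gating value at least $1/l$. **Assumptions on the pre-trained model.** $\|w_s^{(0)}\|\le\frac12\log l$ and $\|w^{(s,0)}_r\|=O(1)$ for all $s,r$. For $i=1,2$ there is an important expert $s\in S_i$, i.e. one with $p_i^{(s,0)}\ge p_0$, where $p_0>0$ is a constant; and every important $s\in S_i$ satisfies $|\langle w_s^{(0)},o_i-q\rangle|=\Omega(1/d)$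 for every task-irrelevant $q$ and $\langle w_r^{(s,0)},o_i\rangle\ge0$ for at least a constant positive fraction of $r\in[m]$. **Theorem.** Suppose that $k=O(\sqrt d)$, $\eta_e=O(1)$, $B=\Omega(l^2d^2)$, that $\eta_r$ is of order $\eta_e/(mdl^2)$ with a sufficiently small implied constant, and that $T$ is of order $l^2\sqrt{d\log l}/\eta_e$ with a sufficiently large implied constant. Suppose that at least a fraction $\gamma$ of the experts $s\in S_1$ have $p_1^{(s,0)}=O(1/d)$ and at least a fraction $\gamma$ of the experts $s\in S_2$ have $p_2^{(s,0)}=O(1/d)$. Then, for every fixed $N$ and all sufficiently large $d$, with probability at least $1-d^{-N}$ over the SGD batches the following holds: for every $\rho\in[0,1)$ with $\rho\le\gamma$, if within each of $S_1$ and $S_2$ separately the fraction $\rho$ of the experts with the smallest $\Delta_s^{(T)}$ is pruned (numbers rounded either way, ties broken arbitrarily), then the pruned model $\hat f^{(T;\rho)}=f_R$ at iteration $T$, with $R$ the set of retained experts, satisfies $$\mathbb P_{(x,y)\sim\mathcal D}\big[\,y\,\hat f^{(T;\rho)}(x)>0\,\big]=1.$$ In detail, the quantifiers are as follows. Let the constants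 in all the other $O,\Omega$ assumptions and an upper bound for $l$ be given. There is $\bar\eta>0$ such that for every $\underline\eta>0$ there is $\underline\tau>0$ such that for all $\bar\tau$, all $\beta>0$ and all $N$ there is $d_0$ such that the claim holds whenever $d\ge d_0$, $\underline\eta\,\eta_e/(mdl^2)\le\eta_r\le\bar\eta\,\eta_e/(mdl^2)$, $B\ge\beta l^2d^2$ and $\underline\tau\, l^2\sqrt{d\log l}/\eta_e\le T\le\bar\tau\, l^2\sqrt{d\log l}/\eta_e$; $d_0$ does not depend on $n,m,k,l,B,T,\eta_e,\eta_r$, the data distribution or the weights. -/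

import Mathlib

open MeasureTheory ProbabilityTheory

noncomputable section

namespace MoE

/-- The token space `ℝ^d` with its Euclidean structure. -/
abbrev Vec (d : ℕ) := EuclideanSpace ℝ (Fin d)

/-- Trainable weights of an MoE layer with `k` experts of hidden dimension `m`: the routers `w_s`
and the hidden neurons `w_r^(s)`. -/
structure Weights (d m k : ℕ) where
  router : Fin k → Vec d
  neuron : Fin k → Fin m → Vec d

/-- Real value of a sign; labels `y` and output heads `a^(s)` are signs. -/
def sgn (c : ℤˣ) : ℝ := ((c : ℤ) : ℝ)

/-! ### The expert-choice MoE layer -/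

/-- A rule selecting the positions of the top `l` of `n` routing values. Ties may be broken in any
way. -/
def IsTopSelector (n l : ℕ) (sel : (Fin n → ℝ) → Finset (Fin n)) : Prop :=
  ∀ g, (sel g).card = l ∧ ∀ i ∈ sel g, ∀ j ∉ sel g, g j ≤ g i

section Model

variable {n d m k : ℕ}

/-- Routing values `g_j^(s) = ⟨w_s, x^(j)⟩`. -/
def routing (θ : Weights d m k) (s : Fin k) (x : Fin n → Vec d) (j : Fin n) : ℝ :=
  inner ℝ (θ.router s) (x j)

/-- The set `J_s(x)` of the tokens chosen by expert `s`. -/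
def chosen (sel : (Fin n → ℝ) → Finset (Fin n)) (θ : Weights d m k) (s : Fin k)
    (x : Fin n → Vec d) : Finset (Fin n) :=
  sel (routing θ s x)

/-- The gating value `G_j^(s)(x)`. -/
def gate (sel : (Fin n → ℝ) → Finset (Fin n)) (θ : Weights d m k) (s : Fin k)
    (x : Fin n → Vec d) (j : Fin n) : ℝ :=
  if j ∈ chosen sel θ s x then
    Real.exp (routing θ s x j) / ∑ i ∈ chosen sel θ s x, Real.exp (routing θ s x i)
  else 0

/-- `∑_r ReLU ⟨w_r^(s), v⟩`: the expert with all-ones output layer, on the token `v`. -/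
def hidden (θ : Weights d m k) (s : Fin k) (v : Vec d) : ℝ :=
  ∑ r, max (inner ℝ (θ.neuron s r) v) 0

/-- Output of the model in which exactly the experts of `R` are present (`R = univ`: unpruned);
expert `s` is attached to the output by the fixed head `a s`. -/
def output (sel : (Fin n → ℝ) → Finset (Fin n)) (a : Fin k → ℤˣ) (θ : Weights d m k)
    (R : Finset (Fin k)) (x : Fin n → Vec d) : ℝ :=
  ∑ j, ∑ s ∈ R, sgn (a s) * hidden θ s (x j) * gate sel θ s x j

/-! ### Training: SGD on `ℓ(f(x), y) = 1 - y f(x)` -/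

/-- Gradient of `1 - y f(x)` in the neuron `w_r^(s)`. -/
def neuronGrad (sel : (Fin n → ℝ) → Finset (Fin n)) (a : Fin k → ℤˣ) (θ : Weights d m k)
    (s : Fin k) (r : Fin m) (x : Fin n → Vec d) (y : ℤˣ) : Vec d :=
  -(sgn y * sgn (a s)) • ∑ j ∈ chosen sel θ s x,
    (gate sel θ s x j * if 0 ≤ inner ℝ (θ.neuron s r) (x j) then 1 else 0) • x j

/-- Gradient of `1 - y f(x)` in the router `w_s`. -/
def routerGrad (sel : (Fin n → ℝ) → Finset (Fin n)) (a : Fin k → ℤˣ) (θ : Weights d m k)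
    (s : Fin k) (x : Fin n → Vec d) (y : ℤˣ) : Vec d :=
  -(sgn y * sgn (a s)) • ∑ j ∈ chosen sel θ s x,
    (hidden θ s (x j) * gate sel θ s x j) •
      ∑ i ∈ (chosen sel θ s x).erase j, gate sel θ s x i • (x j - x i)

/-- A sample `(x, y)`: for every position the index of the pattern that stands there, and the
label. -/
abbrev Sample (n d : ℕ) := (Fin n → Fin d) × ℤˣ

/-- The tokens of a sample, as vectors, for the pattern set `P`. -/
def tokens (P : Fin d → Vec d) (z : Sample n d) (j : Fin n) : Vec d := P (z.1 j)

/-- One SGD step on a batch of `B` samples. -/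
def sgdStep {B : ℕ} (sel : (Fin n → ℝ) → Finset (Fin n)) (P : Fin d → Vec d) (a : Fin k → ℤˣ)
    (ηe ηr : ℝ) (batch : Fin B → Sample n d) (θ : Weights d m k) : Weights d m k where
  router s := θ.router s -
    ηr • ((1 / (B : ℝ)) • ∑ b, routerGrad sel a θ s (tokens P (batch b)) (batch b).2)
  neuron s r := θ.neuron s r -
    ηe • ((1 / (B : ℝ)) • ∑ b, neuronGrad sel a θ s r (tokens P (batch b)) (batch b).2)

/-- The weights after `t` SGD steps from `θ₀`. -/
def sgd {B : ℕ} (sel : (Fin n → ℝ) → Finset (Fin n)) (P : Fin d → Vec d) (a : Fin k → ℤˣ)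
    (ηe ηr : ℝ) (batches : ℕ → Fin B → Sample n d) (θ₀ : Weights d m k) : ℕ → Weights d m k
  | 0 => θ₀
  | t + 1 => sgdStep sel P a ηe ηr (batches t) (sgd sel P a ηe ηr batches θ₀ t)

/-! ### Pruning -/

/-- Change of the router norm, `Δ_s = ‖w_s^(T)‖ - ‖w_s^(0)‖`. -/
def normChange (θ₀ θ : Weights d m k) (s : Fin k) : ℝ := ‖θ.router s‖ - ‖θ₀.router s‖

/-- The experts with head `c`: `S₁` for `c = 1`, `S₂` for `c = -1`. -/
def headSet (a : Fin k → ℤˣ) (c : ℤˣ) : Finset (Fin k) := Finset.univ.filter fun s => a s = c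

/-- `R` is a set of experts retained after pruning with ratio `ρ`: within each of `S₁`, `S₂` it
consists of a `1 - ρ` fraction of the experts (a non-integral number being rounded either way),
with the largest values of `Δ` (ties broken in any way). -/
def IsRetained (a : Fin k → ℤˣ) (Δ : Fin k → ℝ) (ρ : ℝ) (R : Finset (Fin k)) : Prop :=
  ∀ c : ℤˣ,
    ⌊(1 - ρ) * ((headSet a c).card : ℝ)⌋₊ ≤ (headSet a c ∩ R).card ∧
    (headSet a c ∩ R).card ≤ ⌈(1 - ρ) * ((headSet a c).card : ℝ)⌉₊ ∧
    ∀ s ∈ headSet a c ∩ R, ∀ s' ∈ headSet a c \ R, Δ s' ≤ Δ s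

/-! ### Data model and pre-trained model -/

/-- The data distribution. The patterns `o 1` and `o (-1)` are the task-specific ones; every other
pattern is task-irrelevant. Each class has probability at least `π₀`. -/
structure IsDataModel (o : ℤˣ → Fin d) (A π₀ : ℝ) (D : Measure (Sample n d)) : Prop where
  isProb : IsProbabilityMeasure D
  class_prob : ∀ c : ℤˣ, π₀ ≤ D.real {z | z.2 = c}
  /-- exactly one token is task-specific, and it is the one of the label -/
  task_specific : ∀ᵐ z ∂D, ∃ j, z.1 j = o z.2 ∧ ∀ i, i ≠ j → z.1 i ∉ Set.range o
  /-- a task-irrelevant pattern is equally likely to appear in the two classes -/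
  same_prob : ∀ q, q ∉ Set.range o →
    (cond D {z | z.2 = 1}).real {z | ∃ j, z.1 j = q} =
      (cond D {z | z.2 = -1}).real {z | ∃ j, z.1 j = q}
  /-- a task-irrelevant pattern appears with probability `O(1/d)` -/
  rare : ∀ q, q ∉ Set.range o → D.real {z | ∃ j, z.1 j = q} ≤ A / d

/-- Proficiency of router `s` for the task-specific pattern of class `c`: the probability, given
the class, that the pattern is chosen with gating value at least `1/l`. -/
def proficiency (sel : (Fin n → ℝ) → Finset (Fin n)) (P : Fin d → Vec d) (o : ℤˣ → Fin d) (l : ℕ)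
    (D : Measure (Sample n d)) (θ : Weights d m k) (c : ℤˣ) (s : Fin k) : ℝ :=
  (cond D {z | z.2 = c}).real
    {z | ∃ j ∈ chosen sel θ s (tokens P z), z.1 j = o c ∧ 1 / (l : ℝ) ≤ gate sel θ s (tokens P z) j}

/-- Standing assumptions on the pre-trained model; in each class, "important" means proficiency at
least the constant `p₀`. -/
structure IsPretrained (sel : (Fin n → ℝ) → Finset (Fin n)) (P : Fin d → Vec d) (o : ℤˣ → Fin d)
    (l : ℕ) (D : Measure (Sample n d)) (a : Fin k → ℤˣ) (C₂ p₀ cp ν : ℝ)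
    (θ : Weights d m k) : Prop where
  /-- `l ≥ exp (2 C₁)` for the largest router norm `C₁` -/
  router_norm : ∀ s, ‖θ.router s‖ ≤ Real.log l / 2
  neuron_norm : ∀ s r, ‖θ.neuron s r‖ ≤ C₂
  /-- `S₁` has an expert important for class 1, and `S₂` one for class 2 -/
  exists_important : ∀ c : ℤˣ, ∃ s ∈ headSet a c, p₀ ≤ proficiency sel P o l D θ c s
  /-- routers of important experts separate the task-specific pattern from the irrelevant ones -/
  separated : ∀ c : ℤˣ, ∀ s ∈ headSet a c, p₀ ≤ proficiency sel P o l D θ c s →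
    ∀ q, q ∉ Set.range o → cp / d ≤ |inner ℝ (θ.router s) (P (o c) - P q)|
  /-- a constant fraction of the neurons of important experts is activated by the pattern -/
  activated : ∀ c : ℤˣ, ∀ s ∈ headSet a c, p₀ ≤ proficiency sel P o l D θ c s →
    ν * m ≤ ((Finset.univ.filter fun r => 0 ≤ inner ℝ (θ.neuron s r) (P (o c))).card : ℝ)

end Model

end MoE

end

noncomputable section

/-! ### Samples form a discrete measurable space -/

-- The loss is linear in the output, so each expert is trained independently of the others, and an
-- expert is described by the coordinates of its neurons and its router along the orthonormal
-- patterns (`sgd_isExpertRun`). An expert of class `c` meets `o c` only with sign `+1` and `o (-c)`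
-- only with sign `-1`, while an irrelevant pattern occurs too rarely (a fraction `O(1/d)` of the
-- samples, over `T ~ √d / ηe` steps) to move the neurons noticeably. Hence only the activation of
-- `o c` can become large; all others stay `O(m)` (`activation_other_le`).
--
-- For an important expert, the router may at first lose ground along `o c`, but only during
-- `O(1/ηe)` steps, until the activation of `o c` exceeds the others. A small `ηr` keeps this loss
-- below the initial separation of order `1/d`, so the expert goes on choosing its token
-- (`router_order_preserved`). In the first half of the training its activation reaches order `m *
-- ηe * T`. In the second half the router coordinate `w` along `o c` grows at rate `ηr * activation
-- * Γ(1 - Γ)`. Since `exp w * Γ(1 - Γ)` is bounded below on the samples that feed the expert, `exp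
-- w` grows at least linearly in time, to order `(ηe * T)² / d`, a large constant if `T` has a large
-- constant (`exp_router_ge_of_important`).
--
-- The pivot is the converse: `exp w` cannot exceed its initial value by more than order `ηr *
-- activation * T` (`exp_router_main_le`), so a router grows only if the neurons have grown. As
-- routers move almost only along `o c`, the norm change measures `w`. Any expert whose norm change
-- is at least that of an important one has therefore learned the pattern, whatever it was before
-- training (`learned_of_normChange_ge`). Nothing has to be shown about the training of unimportant
-- experts: it is enough that one expert of each class survives that is at least as good in norm
-- change as an important one (`IsRetained.exists_ge`). Its activation is of order `m * √d` with a
-- large constant and beats the at most `k = O(√d)` wrong contributions of size `O(m)`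
-- (`output_pos`).
--
-- Randomness enters only through `AreGoodBatches`. Hoeffding's inequality and a union bound over
-- `d` patterns and `3 k` pairs of an expert and a time window give a failure probability of order
-- `d * exp (-ζ √d)`.

instance MoE.measurableSingletonClassSign : MeasurableSingletonClass ℤˣ where
  measurableSet_singleton u :=
    ⟨{(u : ℤ)}, measurableSet_singleton _, by ext v; simp [Units.ext_iff]⟩

instance MoE.measurableSingletonClassSample (n d : ℕ) :
    MeasurableSingletonClass (MoE.Sample n d) :=
  inferInstanceAs (MeasurableSingletonClass ((Fin n → Fin d) × ℤˣ))

instance MoE.discreteMeasurableSpaceSample (n d : ℕ) :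
    DiscreteMeasurableSpace (MoE.Sample n d) :=
  have : Finite (MoE.Sample n d) := inferInstanceAs (Finite ((Fin n → Fin d) × ℤˣ))
  inferInstance

namespace MoE

/-! ### Concentration of counts of i.i.d. samples -/

/-- Hoeffding's inequality for the number of indices of a finite set at which an i.i.d. family
hits a given set. -/
theorem hoeffding_upper {Ω 𝓧 ι : Type*} [MeasurableSpace Ω] [MeasurableSpace 𝓧]
    (μ : Measure Ω) [IsProbabilityMeasure μ] (D : Measure 𝓧) (Z : ι → Ω → 𝓧)
    (hZ : ∀ i, HasLaw (Z i) D μ) (hind : iIndepFun Z μ) (A : Set 𝓧) (hA : MeasurableSet A)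
    (I : Finset ι) (ε : ℝ) (hε : 0 ≤ ε) :
    μ.real {ω | (I.card : ℝ) * (D.real A + ε) ≤ ∑ i ∈ I, A.indicator 1 (Z i ω)} ≤
      Real.exp (-(2 * I.card * ε ^ 2)) := by
  rcases I.eq_empty_or_nonempty with rfl | hI
  · simp
  have hcard : (0 : ℝ) < I.card := by exact_mod_cast hI.card_pos
  have hm : Measurable (A.indicator (1 : 𝓧 → ℝ)) := measurable_one.indicator hA
  have hmean : ∀ i, ∫ ω, A.indicator (1 : 𝓧 → ℝ) (Z i ω) ∂μ = D.real A := by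
    intro i
    have := (hZ i).integral_comp (f := A.indicator (1 : 𝓧 → ℝ)) hm.aestronglyMeasurable
    rw [integral_indicator_one hA] at this
    exact this
  have hsub : ∀ i ∈ I, HasSubgaussianMGF
      (fun ω => A.indicator (1 : 𝓧 → ℝ) (Z i ω) - D.real A) ((‖(1 : ℝ) - 0‖₊ / 2) ^ 2) μ := by
    intro i _
    have := hasSubgaussianMGF_of_mem_Icc (μ := μ) (X := fun ω => A.indicator (1 : 𝓧 → ℝ) (Z i ω))
      (a := 0) (b := 1) (hm.comp_aemeasurable (hZ i).aemeasurable)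
      (Filter.Eventually.of_forall fun ω => by
        by_cases h : Z i ω ∈ A <;> simp [h])
    rwa [hmean i] at this
  have hind' : iIndepFun (fun i ω => A.indicator (1 : 𝓧 → ℝ) (Z i ω) - D.real A) μ :=
    hind.comp (fun _ x => A.indicator (1 : 𝓧 → ℝ) x - D.real A) fun _ => hm.sub_const _
  have key := HasSubgaussianMGF.measure_sum_ge_le_of_iIndepFun hind' hsub
    (ε := I.card * ε) (by positivity)
  refine (measureReal_mono ?_).trans (key.trans (le_of_eq ?_))
  · intro ω hω
    simp only [Set.mem_ofPred_eq, Finset.sum_sub_distrib, Finset.sum_const, nsmul_eq_mul] at hω ⊢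
    linarith
  · congr 1
    simp
    field_simp

/-- Hoeffding's inequality, lower tail. -/
theorem hoeffding_lower {Ω 𝓧 ι : Type*} [MeasurableSpace Ω] [MeasurableSpace 𝓧]
    (μ : Measure Ω) [IsProbabilityMeasure μ] (D : Measure 𝓧) [IsProbabilityMeasure D]
    (Z : ι → Ω → 𝓧)
    (hZ : ∀ i, HasLaw (Z i) D μ) (hind : iIndepFun Z μ) (A : Set 𝓧) (hA : MeasurableSet A)
    (I : Finset ι) (ε : ℝ) (hε : 0 ≤ ε) :
    μ.real {ω | ∑ i ∈ I, A.indicator 1 (Z i ω) ≤ (I.card : ℝ) * (D.real A - ε)} ≤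
      Real.exp (-(2 * I.card * ε ^ 2)) := by
  refine (measureReal_mono ?_).trans (hoeffding_upper μ D Z hZ hind Aᶜ hA.compl I ε hε)
  intro ω hω
  have h : ∀ i, Aᶜ.indicator (1 : 𝓧 → ℝ) (Z i ω) = 1 - A.indicator 1 (Z i ω) := by
    intro i
    by_cases h : Z i ω ∈ A <;> simp [h]
  simp only [Set.mem_ofPred_eq, h, Finset.sum_sub_distrib, Finset.sum_const, nsmul_eq_mul,
    probReal_compl_eq_one_sub hA] at hω ⊢
  linarith


/-! ### Batch averages -/

/-- The average over a batch. -/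
def avg {B : ℕ} (f : Fin B → ℝ) : ℝ := 1 / (B : ℝ) * ∑ b, f b

section Avg
variable {B : ℕ} {f g : Fin B → ℝ}

theorem avg_mono (h : ∀ b, f b ≤ g b) : avg f ≤ avg g :=
  mul_le_mul_of_nonneg_left (Finset.sum_le_sum fun b _ => h b) (by positivity)

theorem avg_nonneg (h : ∀ b, 0 ≤ f b) : 0 ≤ avg f :=
  mul_nonneg (by positivity) (Finset.sum_nonneg fun b _ => h b)

theorem avg_const (hB : 0 < B) (x : ℝ) : avg (fun _ : Fin B => x) = x := by
  have : (B : ℝ) ≠ 0 := by positivity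
  simp [avg]
  field_simp

theorem avg_const_mul (x : ℝ) (f : Fin B → ℝ) : avg (fun b => x * f b) = x * avg f := by
  simp only [avg, ← Finset.mul_sum]
  ring

theorem avg_neg (f : Fin B → ℝ) : avg (fun b => -f b) = -avg f := by
  simp [avg]

theorem abs_avg_le (h : ∀ b, |f b| ≤ g b) : |avg f| ≤ avg g := by
  refine abs_le.2 ⟨?_, avg_mono fun b => (abs_le.1 (h b)).2⟩
  rw [← avg_neg]
  exact avg_mono fun b => (abs_le.1 (h b)).1

end Avg

/-! ### Training of one expert in the coordinates of the patterns -/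

/-- Total activation `∑_r ReLU (U_r p)` of the pattern `p`. -/
def activation {m d : ℕ} (U : Fin m → Fin d → ℝ) (p : Fin d) : ℝ := ∑ r, max (U r p) 0

theorem activation_nonneg {m d : ℕ} (U : Fin m → Fin d → ℝ) (p : Fin d) : 0 ≤ activation U p :=
  Finset.sum_nonneg fun _ _ => le_max_right _ _

theorem activation_le {m d : ℕ} {U : Fin m → Fin d → ℝ} {p : Fin d} {C : ℝ} (hC : 0 ≤ C)
    (h : ∀ r, U r p ≤ C) : activation U p ≤ m * C := by
  calc activation U p ≤ ∑ _r : Fin m, C := Finset.sum_le_sum fun r _ => max_le (h r) hC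
    _ = m * C := by simp

/-- Average of the activation under the weights `Γ`. -/
def meanActivation {m d : ℕ} (Γ : Fin d → ℝ) (U : Fin m → Fin d → ℝ) : ℝ :=
  ∑ q, Γ q * activation U q

/-- The evolution of one expert under SGD: `U t r p` and `W t p` are the coordinates of its neurons
and its router along the pattern `p`, `σ t b` is the product of the label of the sample `b` of
step `t` and the head, `Γ t b p` the total gating value of `p` in that sample, and `occ t b p`
bounds it. The expert sees `o` only with sign `1`, and `o'` only with sign `-1`. -/
structure IsExpertRun {m d B : ℕ} (o o' : Fin d) (ηe ηr : ℝ) (U : ℕ → Fin m → Fin d → ℝ)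
    (W : ℕ → Fin d → ℝ) (σ : ℕ → Fin B → ℝ) (Γ occ : ℕ → Fin B → Fin d → ℝ) : Prop where
  neuron_step : ∀ t r p, U (t + 1) r p =
    U t r p + ηe * avg fun b => σ t b * if 0 ≤ U t r p then Γ t b p else 0
  router_step : ∀ t p, W (t + 1) p = W t p +
    ηr * avg fun b => σ t b * (Γ t b p * (activation (U t) p - meanActivation (Γ t b) (U t)))
  gate_nonneg : ∀ t b p, 0 ≤ Γ t b p
  gate_sum : ∀ t b, ∑ p, Γ t b p = 1
  gate_le_occ : ∀ t b p, Γ t b p ≤ occ t b p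
  label : ∀ t b, (σ t b = 1 ∧ Γ t b o' = 0) ∨ (σ t b = -1 ∧ Γ t b o = 0)
  batch_pos : 0 < B
  expert_rate_nonneg : 0 ≤ ηe
  router_rate_nonneg : 0 ≤ ηr

namespace IsExpertRun

variable {m d B : ℕ} {o o' : Fin d} {ηe ηr : ℝ} {U : ℕ → Fin m → Fin d → ℝ}
  {W : ℕ → Fin d → ℝ} {σ : ℕ → Fin B → ℝ} {Γ occ : ℕ → Fin B → Fin d → ℝ}

section Basic
variable (h : IsExpertRun o o' ηe ηr U W σ Γ occ)
include h

theorem gate_le_one (t : ℕ) (b : Fin B) (p : Fin d) : Γ t b p ≤ 1 := by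
  rw [← h.gate_sum t b]
  exact Finset.single_le_sum (fun q _ => h.gate_nonneg t b q) (Finset.mem_univ p)

theorem occ_nonneg (t : ℕ) (b : Fin B) (p : Fin d) : 0 ≤ occ t b p :=
  (h.gate_nonneg t b p).trans (h.gate_le_occ t b p)

theorem sign_mul_gate (t : ℕ) (b : Fin B) : σ t b * Γ t b o = Γ t b o := by
  rcases h.label t b with ⟨h1, _⟩ | ⟨_, h2⟩
  · rw [h1, one_mul]
  · rw [h2, mul_zero]

theorem sign_mul_gate' (t : ℕ) (b : Fin B) : σ t b * Γ t b o' = -Γ t b o' := by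
  rcases h.label t b with ⟨_, h2⟩ | ⟨h1, _⟩
  · rw [h2, mul_zero, neg_zero]
  · rw [h1, neg_one_mul]

theorem abs_sign (t : ℕ) (b : Fin B) : |σ t b| = 1 := by
  rcases h.label t b with ⟨h1, _⟩ | ⟨h1, _⟩ <;> simp [h1]

/-! #### Neurons -/

/-- The sign disappears because samples of the other class give `o` no gating value. So the
coordinate along `o` can only grow, and a neuron active on `o` stays active. -/
theorem neuron_step_main (t : ℕ) (r : Fin m) : U (t + 1) r o =
    U t r o + ηe * if 0 ≤ U t r o then avg fun b => Γ t b o else 0 := by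
  rw [h.neuron_step]
  split_ifs with hU
  · simp only [h.sign_mul_gate]
  · simp [avg]

theorem neuron_le_succ (t : ℕ) (r : Fin m) : U t r o ≤ U (t + 1) r o := by
  rw [h.neuron_step_main]
  have := h.expert_rate_nonneg
  have := avg_nonneg (f := fun b => Γ t b o) fun b => h.gate_nonneg t b o
  split_ifs
  · nlinarith
  · simp

theorem neuron_succ_le (t : ℕ) (r : Fin m) : U (t + 1) r o ≤ U t r o + ηe := by
  rw [h.neuron_step_main]
  have := h.expert_rate_nonneg
  have := (avg_mono (f := fun b => Γ t b o) fun b => h.gate_le_one t b o).trans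
    (avg_const h.batch_pos 1).le
  split_ifs
  · nlinarith
  · simpa

theorem neuron_monotone (r : Fin m) : Monotone fun t => U t r o :=
  monotone_nat_of_le_succ fun t => h.neuron_le_succ t r

theorem neuron_le_linear (t : ℕ) (r : Fin m) : U t r o ≤ U 0 r o + ηe * t := by
  induction t with
  | zero => simp
  | succ t ih =>
    have := h.neuron_succ_le t r
    push_cast
    linarith

theorem neuron_opposite_le (t : ℕ) (r : Fin m) : U t r o' ≤ U 0 r o' := by
  induction t with
  | zero => rfl
  | succ t ih =>
    refine le_trans ?_ ih
    rw [h.neuron_step]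
    have h0 : avg (fun b => σ t b * if 0 ≤ U t r o' then Γ t b o' else 0) ≤ 0 := by
      refine (avg_mono (g := fun _ => 0) fun b => ?_).trans (avg_const h.batch_pos 0).le
      split_ifs
      · rw [h.sign_mul_gate']
        linarith [h.gate_nonneg t b o']
      · simp
    nlinarith [h.expert_rate_nonneg]

theorem neuron_irrelevant_le (t : ℕ) (r : Fin m) (q : Fin d) :
    U t r q ≤ U 0 r q + ηe * ∑ i ∈ Finset.range t, avg fun b => occ i b q := by
  induction t with
  | zero => simp
  | succ t ih =>
    rw [Finset.sum_range_succ, h.neuron_step]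
    have h0 : avg (fun b => σ t b * if 0 ≤ U t r q then Γ t b q else 0) ≤
        avg fun b => occ t b q := by
      refine avg_mono fun b => ?_
      have h1 := h.gate_nonneg t b q
      have h2 := h.gate_le_occ t b q
      rcases h.label t b with ⟨hs, _⟩ | ⟨hs, _⟩ <;> rw [hs] <;> split_ifs <;> linarith
    nlinarith [h.expert_rate_nonneg]

theorem activation_monotone : Monotone fun t => activation (U t) o :=
  fun _ _ hst => Finset.sum_le_sum fun r _ => max_le_max (h.neuron_monotone r hst) le_rfl

theorem mean_le {t : ℕ} {b : Fin B} {C : ℝ} (hC : ∀ p, Γ t b p ≠ 0 → activation (U t) p ≤ C) :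
    meanActivation (Γ t b) (U t) ≤ C := by
  calc meanActivation (Γ t b) (U t) ≤ ∑ q, Γ t b q * C := by
        refine Finset.sum_le_sum fun q _ => ?_
        by_cases h0 : Γ t b q = 0
        · simp [h0]
        · exact mul_le_mul_of_nonneg_left (hC q h0) (h.gate_nonneg t b q)
    _ = C := by rw [← Finset.sum_mul, h.gate_sum, one_mul]

theorem mean_nonneg (t : ℕ) (b : Fin B) : 0 ≤ meanActivation (Γ t b) (U t) :=
  Finset.sum_nonneg fun q _ => mul_nonneg (h.gate_nonneg t b q) (activation_nonneg _ _)

theorem mean_ge (t : ℕ) (b : Fin B) :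
    Γ t b o * activation (U t) o ≤ meanActivation (Γ t b) (U t) :=
  Finset.single_le_sum (f := fun q => Γ t b q * activation (U t) q)
    (fun q _ => mul_nonneg (h.gate_nonneg t b q) (activation_nonneg _ _)) (Finset.mem_univ o)

theorem mean_le_main {t : ℕ} {b : Fin B} {C : ℝ} (hC : ∀ p ≠ o, activation (U t) p ≤ C) :
    meanActivation (Γ t b) (U t) ≤ Γ t b o * activation (U t) o + (1 - Γ t b o) * C := by
  have hs := h.gate_sum t b
  rw [← Finset.add_sum_erase _ _ (Finset.mem_univ o)] at hs
  rw [meanActivation, ← Finset.add_sum_erase _ _ (Finset.mem_univ o)]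
  have : ∑ q ∈ Finset.univ.erase o, Γ t b q * activation (U t) q ≤
      ∑ q ∈ Finset.univ.erase o, Γ t b q * C :=
    Finset.sum_le_sum fun q hq => mul_le_mul_of_nonneg_left (hC q (Finset.ne_of_mem_erase hq))
      (h.gate_nonneg t b q)
  rw [← Finset.sum_mul] at this
  have h2 : ∑ q ∈ Finset.univ.erase o, Γ t b q = 1 - Γ t b o := by linarith
  rw [h2] at this
  linarith

end Basic

end IsExpertRun

/-! ### Summation of one-step inequalities, and runs in which irrelevant patterns are rare -/

theorem le_add_sum_of_step_le {x c : ℕ → ℝ} {T : ℕ} (h : ∀ t < T, x (t + 1) ≤ x t + c t) :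
    ∀ t ≤ T, x t ≤ x 0 + ∑ i ∈ Finset.range t, c i := by
  intro t
  induction t with
  | zero => simp
  | succ t ih =>
    intro ht
    rw [Finset.sum_range_succ]
    linarith [h t ht, ih (by omega)]

theorem add_sum_le_of_le_step {x c : ℕ → ℝ} {S : ℕ} :
    ∀ {T : ℕ}, S ≤ T → (∀ t, S ≤ t → t < T → x t + c t ≤ x (t + 1)) →
      x S + ∑ i ∈ Finset.Ico S T, c i ≤ x T := by
  intro T hST
  induction T, hST using Nat.le_induction with
  | base => simp
  | succ T hST ih =>
    intro h
    rw [Finset.sum_Ico_succ_top hST]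
    linarith [h T hST (by omega), ih fun t h1 h2 => h t h1 (by omega)]

/-- A training run up to time `T` in which the initial coordinates of the neurons are at most
`C - 1` and each task-irrelevant pattern occurs in total at most `ε` times per sample slot. -/
structure IsControlledRun {m d B : ℕ} (o o' : Fin d) (ηe ηr : ℝ) (U : ℕ → Fin m → Fin d → ℝ)
    (W : ℕ → Fin d → ℝ) (σ : ℕ → Fin B → ℝ) (Γ occ : ℕ → Fin B → Fin d → ℝ)
    (C ε : ℝ) (T : ℕ) : Prop extends IsExpertRun o o' ηe ηr U W σ Γ occ where
  one_le : 1 ≤ C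
  neuron_init : ∀ r p, U 0 r p ≤ C - 1
  occ_le : ∀ q, q ≠ o → q ≠ o' → ∑ i ∈ Finset.range T, avg (fun b => occ i b q) ≤ ε
  rate_occ_le : ηe * ε ≤ 1

namespace IsControlledRun

variable {m d B : ℕ} {o o' : Fin d} {ηe ηr : ℝ} {U : ℕ → Fin m → Fin d → ℝ}
  {W : ℕ → Fin d → ℝ} {σ : ℕ → Fin B → ℝ} {Γ occ : ℕ → Fin B → Fin d → ℝ} {C ε : ℝ} {T : ℕ}
  (h : IsControlledRun o o' ηe ηr U W σ Γ occ C ε T)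
include h

/-- Along `o'` all updates are negative or zero. Along an irrelevant pattern the total gain is at
most `ηe * ε ≤ 1`, which is the unit kept in reserve between `C - 1` and `C`. -/
theorem activation_other_le {t : ℕ} (ht : t ≤ T) {p : Fin d} (hp : p ≠ o) :
    activation (U t) p ≤ m * C := by
  refine activation_le (by linarith [h.one_le]) fun r => ?_
  by_cases hp' : p = o'
  · subst hp'
    linarith [h.neuron_opposite_le t r, h.neuron_init r p]
  · have h1 := h.neuron_irrelevant_le t r p
    have h2 : ∑ i ∈ Finset.range t, avg (fun b => occ i b p) ≤ ε :=
      (Finset.sum_le_sum_of_subset_of_nonneg (Finset.range_subset_range.2 ht)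
        fun i _ _ => avg_nonneg fun b => h.occ_nonneg i b p).trans (h.occ_le p hp hp')
    have h3 := mul_le_mul_of_nonneg_left h2 h.expert_rate_nonneg
    linarith [h.neuron_init r p, h.rate_occ_le]

theorem activation_le_linear {t : ℕ} (ht : t ≤ T) (p : Fin d) :
    activation (U t) p ≤ m * (C + ηe * T) := by
  have hT : ηe * (t : ℝ) ≤ ηe * T :=
    mul_le_mul_of_nonneg_left (by exact_mod_cast ht) h.expert_rate_nonneg
  have hT0 : 0 ≤ ηe * (T : ℝ) := mul_nonneg h.expert_rate_nonneg (by positivity)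
  by_cases hp : p = o
  · subst hp
    refine activation_le (by linarith [h.one_le]) fun r => ?_
    linarith [h.neuron_le_linear t r, h.neuron_init r p]
  · refine (h.activation_other_le ht hp).trans ?_
    gcongr
    linarith

theorem mC_nonneg : 0 ≤ (m : ℝ) * C := mul_nonneg (by positivity) (by linarith [h.one_le])

/-- Upwards, the growing activation of `o` plays no role: with sign `+1` the mean activation is only
subtracted, and with sign `-1` the pattern `o` is not in the mean. This is why the bound has `C` and
not `C + ηe * T`, and why the accumulated gain can be made smaller than a separation of order `1/d`.
-/
theorem router_irrelevant_step_le {t : ℕ} (ht : t < T) {q : Fin d} (hq : q ≠ o) :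
    W (t + 1) q ≤ W t q + ηr * (m * C) * avg fun b => occ t b q := by
  rw [h.router_step, mul_assoc, ← avg_const_mul (m * C)]
  refine add_le_add_right (mul_le_mul_of_nonneg_left (avg_mono fun b => ?_)
    h.router_rate_nonneg) _
  have h0 := h.gate_nonneg t b q
  have h1 := h.gate_le_occ t b q
  have hH := h.activation_other_le ht.le hq
  have hH0 := activation_nonneg (U t) q
  have hM0 := h.mean_nonneg t b
  have hC := h.mC_nonneg
  rcases h.label t b with ⟨hs, _⟩ | ⟨hs, ho⟩
  · rw [hs]
    nlinarith
  · have hM : meanActivation (Γ t b) (U t) ≤ m * C :=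
      h.mean_le fun p hp => h.activation_other_le ht.le (by rintro rfl; exact hp ho)
    rw [hs]
    nlinarith

/-- Downwards, the activation of `o` enters through the mean. This weaker bound serves only to keep
the coordinates bounded and to estimate the norm of the router. -/
theorem router_irrelevant_step_abs {t : ℕ} (ht : t < T) (q : Fin d) :
    |W (t + 1) q - W t q| ≤ ηr * (m * (C + ηe * T)) * avg fun b => occ t b q := by
  rw [h.router_step, add_sub_cancel_left, abs_mul, abs_of_nonneg h.router_rate_nonneg, mul_assoc,
    ← avg_const_mul]
  refine mul_le_mul_of_nonneg_left (abs_avg_le fun b => ?_) h.router_rate_nonneg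
  have hM : meanActivation (Γ t b) (U t) ≤ m * (C + ηe * T) :=
    h.mean_le fun p _ => h.activation_le_linear ht.le p
  have hH := h.activation_le_linear ht.le q
  have hH0 := activation_nonneg (U t) q
  have hM0 := h.mean_nonneg t b
  rw [abs_mul, h.abs_sign, one_mul, abs_mul, abs_of_nonneg (h.gate_nonneg t b q), mul_comm]
  exact mul_le_mul (abs_le.2 ⟨by linarith, by linarith⟩) (h.gate_le_occ t b q)
    (h.gate_nonneg t b q) (by linarith)

theorem router_opposite_step_abs {t : ℕ} (ht : t < T) (hoo : o' ≠ o) :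
    |W (t + 1) o' - W t o'| ≤ ηr * (m * C) := by
  rw [h.router_step, add_sub_cancel_left, abs_mul, abs_of_nonneg h.router_rate_nonneg]
  refine mul_le_mul_of_nonneg_left ?_ h.router_rate_nonneg
  refine (abs_avg_le (g := fun _ => m * C) fun b => ?_).trans (avg_const h.batch_pos _).le
  have hH := h.activation_other_le ht.le hoo
  have hH0 := activation_nonneg (U t) o'
  have hM0 := h.mean_nonneg t b
  rcases h.label t b with ⟨_, ho⟩ | ⟨hs, ho⟩
  · simpa [ho] using h.mC_nonneg
  · have hM : meanActivation (Γ t b) (U t) ≤ m * C :=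
      h.mean_le fun p hp => h.activation_other_le ht.le (by rintro rfl; exact hp ho)
    rw [hs, abs_mul, abs_neg, abs_one, one_mul, abs_mul, abs_of_nonneg (h.gate_nonneg t b o')]
    have : |activation (U t) o' - meanActivation (Γ t b) (U t)| ≤ m * C :=
      abs_le.2 ⟨by linarith, by linarith⟩
    have h1 := h.gate_le_one t b o'
    have h2 := h.gate_nonneg t b o'
    nlinarith [abs_nonneg (activation (U t) o' - meanActivation (Γ t b) (U t))]

theorem router_main_step (t : ℕ) : W (t + 1) o = W t o +
    ηr * avg fun b => Γ t b o * (activation (U t) o - meanActivation (Γ t b) (U t)) := by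
  rw [h.router_step]
  simp only [← mul_assoc, h.sign_mul_gate]

/-- The mean contains `o` itself with weight `Γ`, so the increment is governed by `Γ(1 - Γ)`. The
saturation factor `1 - Γ` is what makes `exp (W t o)` the natural quantity to follow. -/
theorem router_main_step_le (t : ℕ) : W (t + 1) o ≤ W t o +
    ηr * (activation (U t) o * avg fun b => Γ t b o * (1 - Γ t b o)) := by
  rw [h.router_main_step, ← avg_const_mul (activation (U t) o)]
  have := h.router_rate_nonneg
  gcongr
  refine avg_mono fun b => ?_
  nlinarith [h.mean_ge t b, h.gate_nonneg t b o]

theorem router_main_step_ge {t : ℕ} (ht : t < T) : W t o +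
    ηr * ((activation (U t) o - m * C) * avg fun b => Γ t b o * (1 - Γ t b o)) ≤ W (t + 1) o := by
  rw [h.router_main_step, ← avg_const_mul (activation (U t) o - m * C)]
  have := h.router_rate_nonneg
  gcongr
  refine avg_mono fun b => ?_
  have := h.mean_le_main (t := t) (b := b) fun p hp => h.activation_other_le ht.le hp
  nlinarith [h.gate_nonneg t b o]

theorem avg_gate_mul_nonneg (t : ℕ) : 0 ≤ avg fun b => Γ t b o * (1 - Γ t b o) :=
  avg_nonneg fun b => mul_nonneg (h.gate_nonneg t b o) (by linarith [h.gate_le_one t b o])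

theorem avg_gate_mul_le_one (t : ℕ) : (avg fun b => Γ t b o * (1 - Γ t b o)) ≤ 1 :=
  (avg_mono (g := fun _ => 1) fun b => by
    nlinarith [h.gate_nonneg t b o, h.gate_le_one t b o]).trans (avg_const h.batch_pos 1).le

/-! #### Accumulated change of the router -/

theorem router_irrelevant_le {t : ℕ} (ht : t ≤ T) {q : Fin d} (hq : q ≠ o) (hq' : q ≠ o') :
    W t q ≤ W 0 q + ηr * (m * C) * ε := by
  have h1 := le_add_sum_of_step_le (x := fun t => W t q)
    (fun t ht => h.router_irrelevant_step_le ht hq) t ht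
  rw [← Finset.mul_sum] at h1
  have h2 : ∑ i ∈ Finset.range t, avg (fun b => occ i b q) ≤ ε :=
    (Finset.sum_le_sum_of_subset_of_nonneg (Finset.range_subset_range.2 ht)
      fun i _ _ => avg_nonneg fun b => h.occ_nonneg i b q).trans (h.occ_le q hq hq')
  have := mul_le_mul_of_nonneg_left h2 (mul_nonneg h.router_rate_nonneg h.mC_nonneg)
  linarith

theorem router_irrelevant_abs {t : ℕ} (ht : t ≤ T) {q : Fin d} (hq : q ≠ o) (hq' : q ≠ o') :
    |W t q - W 0 q| ≤ ηr * (m * (C + ηe * T)) * ε := by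
  have h1 := le_add_sum_of_step_le (x := fun t => |W t q - W 0 q|)
    (fun t ht => (abs_sub_le _ (W t q) _).trans
      ((add_comm _ _).le.trans (add_le_add_right (h.router_irrelevant_step_abs ht q) _))) t ht
  rw [← Finset.mul_sum, sub_self, abs_zero, zero_add] at h1
  have h2 : ∑ i ∈ Finset.range t, avg (fun b => occ i b q) ≤ ε :=
    (Finset.sum_le_sum_of_subset_of_nonneg (Finset.range_subset_range.2 ht)
      fun i _ _ => avg_nonneg fun b => h.occ_nonneg i b q).trans (h.occ_le q hq hq')
  refine h1.trans (mul_le_mul_of_nonneg_left h2 (mul_nonneg h.router_rate_nonneg ?_))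
  have := mul_nonneg h.expert_rate_nonneg (Nat.cast_nonneg (α := ℝ) T)
  exact mul_nonneg (by positivity) (by linarith [h.one_le])

theorem router_opposite_abs {t : ℕ} (ht : t ≤ T) (hoo : o' ≠ o) :
    |W t o' - W 0 o'| ≤ ηr * (m * C) * t := by
  have h1 := le_add_sum_of_step_le (x := fun t => |W t o' - W 0 o'|)
    (fun t ht => (abs_sub_le _ (W t o') _).trans
      ((add_comm _ _).le.trans (add_le_add_right (h.router_opposite_step_abs ht hoo) _))) t ht
  simp only [sub_self, abs_zero, zero_add, Finset.sum_const, Finset.card_range,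
    nsmul_eq_mul] at h1
  linarith

theorem router_main_ge {t : ℕ} (ht : t ≤ T) : W 0 o - ηr * (m * C) * t ≤ W t o := by
  have h1 := le_add_sum_of_step_le (x := fun t => -W t o) (c := fun _ => ηr * (m * C)) (T := T)
    (fun t ht => by
      have h2 := h.router_main_step_ge ht
      have h3 := h.avg_gate_mul_nonneg t
      have h4 := h.avg_gate_mul_le_one t
      have h5 := activation_nonneg (U t) o
      have h6 : -(m * C) ≤ (activation (U t) o - m * C) *
          avg fun b => Γ t b o * (1 - Γ t b o) := by
        nlinarith [h.mC_nonneg]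
      have := mul_le_mul_of_nonneg_left h6 h.router_rate_nonneg
      linarith) t ht
  simp only [Finset.sum_const, Finset.card_range, nsmul_eq_mul] at h1
  linarith

theorem router_main_mono {s t : ℕ} (hst : s ≤ t) (ht : t ≤ T)
    (hs : m * C ≤ activation (U s) o) : W s o ≤ W t o := by
  have := add_sum_le_of_le_step (x := fun t => W t o) (c := fun _ => 0) hst (fun i h1 h2 => by
    have h3 := h.router_main_step_ge (h2.trans_le ht)
    have h4 := h.activation_monotone h1
    have : 0 ≤ ηr * ((activation (U i) o - m * C) * avg fun b => Γ i b o * (1 - Γ i b o)) :=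
      mul_nonneg h.router_rate_nonneg
        (mul_nonneg (by simp only at h4; linarith) (h.avg_gate_mul_nonneg i))
    linarith)
  simpa using this

/-! #### Growth of the neurons and of the router along `o` -/

/-- Each neuron that is active on `o` at the start remains so and collects every update; there are
at least `ν * m` of them. -/
theorem activation_main_ge {e : ℕ → Fin B → ℝ} {g : ℝ} {S : ℕ} (hg : 0 ≤ g)
    (he : ∀ t < S, ∀ b, g * e t b ≤ Γ t b o) (he0 : ∀ t b, 0 ≤ e t b) {ν : ℝ}
    (hν : ν * m ≤ ((Finset.univ.filter fun r => 0 ≤ U 0 r o).card : ℝ)) :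
    ν * m * (ηe * g * ∑ i ∈ Finset.range S, avg (e i)) ≤ activation (U S) o := by
  have hη := h.expert_rate_nonneg
  have hsum : 0 ≤ ηe * g * ∑ i ∈ Finset.range S, avg (e i) :=
    mul_nonneg (mul_nonneg hη hg) (Finset.sum_nonneg fun i _ => avg_nonneg (he0 i))
  have key : ∀ r, 0 ≤ U 0 r o → ηe * g * ∑ i ∈ Finset.range S, avg (e i) ≤ U S r o := by
    intro r hr
    have := add_sum_le_of_le_step (x := fun t => U t r o) (c := fun t => ηe * g * avg (e t))
      (Nat.zero_le S) (fun i _ hi => by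
        rw [h.neuron_step_main, if_pos (hr.trans (h.neuron_monotone r (Nat.zero_le i))), mul_assoc,
          ← avg_const_mul]
        gcongr
        exact avg_mono fun b => he i hi b)
    rw [← Finset.mul_sum, Nat.Ico_zero_eq_range] at this
    linarith
  calc ν * m * (ηe * g * ∑ i ∈ Finset.range S, avg (e i))
      ≤ ((Finset.univ.filter fun r => 0 ≤ U 0 r o).card : ℝ) *
        (ηe * g * ∑ i ∈ Finset.range S, avg (e i)) := mul_le_mul_of_nonneg_right hν hsum
    _ = ∑ r ∈ Finset.univ.filter (fun r => 0 ≤ U 0 r o),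
        (ηe * g * ∑ i ∈ Finset.range S, avg (e i)) := by simp
    _ ≤ ∑ r ∈ Finset.univ.filter (fun r => 0 ≤ U 0 r o), max (U S r o) 0 :=
        Finset.sum_le_sum fun r hr =>
          (key r (Finset.mem_filter.1 hr).2).trans (le_max_left _ _)
    _ ≤ activation (U S) o := Finset.sum_le_sum_of_subset_of_nonneg (Finset.subset_univ _)
        fun _ _ _ => le_max_right _ _

/-- By `exp u ≥ 1 + u`, the increment of `exp W` is at least `exp W` times that of `W`. The factor
`exp W` compensates the saturation, so the growth of `exp W` is at least linear. -/
theorem exp_router_main_ge {e : ℕ → Fin B → ℝ} {g Y : ℝ} {S : ℕ} (hST : S ≤ T) (hY : 0 ≤ Y)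
    (hact : m * C + Y ≤ activation (U S) o)
    (he : ∀ t < T, ∀ b, g * e t b ≤ Real.exp (W t o) * (Γ t b o * (1 - Γ t b o))) :
    ηr * Y * g * ∑ i ∈ Finset.Ico S T, avg (e i) ≤ Real.exp (W T o) := by
  have hη := h.router_rate_nonneg
  have := add_sum_le_of_le_step (x := fun t => Real.exp (W t o))
    (c := fun t => ηr * Y * g * avg (e t)) hST (fun i h1 h2 => by
      have h3 := h.router_main_step_ge h2
      have h4 := h.activation_monotone h1
      simp only at h4
      have h5 := h.avg_gate_mul_nonneg i
      set X := avg fun b => Γ i b o * (1 - Γ i b o) with hX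
      have h6 : g * avg (e i) ≤ Real.exp (W i o) * X := by
        rw [hX, ← avg_const_mul, ← avg_const_mul]
        exact avg_mono fun b => he i h2 b
      have h7 : ηr * Y * X ≤ W (i + 1) o - W i o := by
        have : ηr * (Y * X) ≤ ηr * ((activation (U i) o - m * C) * X) := by
          gcongr
          linarith
        linarith
      have h8 := Real.add_one_le_exp (W (i + 1) o - W i o)
      have h9 : Real.exp (W (i + 1) o) =
          Real.exp (W i o) * Real.exp (W (i + 1) o - W i o) := by
        rw [← Real.exp_add]; ring_nf
      have h10 : ηr * Y * (g * avg (e i)) ≤ ηr * Y * (Real.exp (W i o) * X) := by gcongr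
      rw [h9]
      have h11 := mul_le_mul_of_nonneg_left h8 (Real.exp_pos (W i o)).le
      have h12 := mul_le_mul_of_nonneg_left h7 (Real.exp_pos (W i o)).le
      linarith)
  rw [← Finset.mul_sum] at this
  linarith [Real.exp_pos (W S o)]

/-- The steps are at most `1`, so `exp δ ≤ 1 + 2 δ` reverses the linear growth, and monotonicity
lets the final activation bound all earlier ones. Read backwards, a large router coordinate forces a
large activation. -/
theorem exp_router_main_le {S : ℝ} (hstep : ηr * (m * (C + ηe * T)) ≤ 1)
    (hS : ∀ t < T, ∀ b, Real.exp (W t o) * (Γ t b o * (1 - Γ t b o)) ≤ S) :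
    Real.exp (W T o) ≤ Real.exp (W 0 o) + 2 * ηr * activation (U T) o * S * T := by
  have hη := h.router_rate_nonneg
  have := le_add_sum_of_step_le (x := fun t => Real.exp (W t o))
    (c := fun _ => 2 * ηr * activation (U T) o * S) (T := T) (fun i hi => by
      have h3 := h.router_main_step_le i
      have h4 := h.activation_monotone hi.le
      simp only at h4
      have h5 := h.avg_gate_mul_nonneg i
      have h5' := h.avg_gate_mul_le_one i
      have hH0 := activation_nonneg (U i) o
      have hH1 := activation_nonneg (U T) o
      set X := avg fun b => Γ i b o * (1 - Γ i b o) with hX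
      have h6 : Real.exp (W i o) * X ≤ S := by
        rw [hX, ← avg_const_mul]
        exact (avg_mono fun b => hS i hi b).trans (avg_const h.batch_pos S).le
      set δ := ηr * (activation (U i) o * X) with hδ
      have hδ0 : 0 ≤ δ := by positivity
      have hδ1 : δ ≤ 1 := by
        refine le_trans ?_ hstep
        refine mul_le_mul_of_nonneg_left ?_ hη
        nlinarith [h.activation_le_linear hi.le o]
      have h8 : Real.exp δ ≤ 1 + 2 * δ := by
        have := Real.abs_exp_sub_one_le (x := δ) (by rwa [abs_of_nonneg hδ0])
        rw [abs_of_nonneg hδ0] at this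
        linarith [(abs_le.1 this).2]
      calc Real.exp (W (i + 1) o) ≤ Real.exp (W i o + δ) := Real.exp_le_exp.2 h3
        _ = Real.exp (W i o) * Real.exp δ := Real.exp_add _ _
        _ ≤ Real.exp (W i o) * (1 + 2 * δ) := by gcongr
        _ = Real.exp (W i o) + 2 * ηr * activation (U i) o * (Real.exp (W i o) * X) := by
            rw [hδ]; ring
        _ ≤ Real.exp (W i o) + 2 * ηr * activation (U T) o * S := by
            have : 0 ≤ S := le_trans (by positivity) h6
            gcongr) T le_rfl
  simp only [Finset.sum_const, Finset.card_range, nsmul_eq_mul] at this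
  linarith

end IsControlledRun

/-! ### Important experts keep choosing their pattern and keep growing -/

namespace IsControlledRun

variable {m d B : ℕ} {o o' : Fin d} {ηe ηr : ℝ} {U : ℕ → Fin m → Fin d → ℝ}
  {W : ℕ → Fin d → ℝ} {σ : ℕ → Fin B → ℝ} {Γ occ : ℕ → Fin B → Fin d → ℝ} {C ε : ℝ} {T : ℕ}
  (h : IsControlledRun o o' ηe ηr U W σ Γ occ C ε T)
include h

/-- If the slots marked by `e` feed the neurons as long as no irrelevant pattern gains more than
`δ` on `o`, and the activation of `o` exceeds that of the other patterns at a time `S` before which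
the router cannot lose more than `δ / 2`, then no irrelevant pattern ever gains more than `δ`. -/
theorem router_order_preserved {e : ℕ → Fin B → ℝ} {g δ ν : ℝ} {S : ℕ} (hST : S ≤ T) (hg : 0 ≤ g)
    (he0 : ∀ t b, 0 ≤ e t b)
    (hgate : ∀ t < T, ∀ b, (∀ q, q ≠ o → q ≠ o' → W t q - W t o ≤ W 0 q - W 0 o + δ) →
      g * e t b ≤ Γ t b o)
    (hε : ηr * (m * C) * ε ≤ δ / 2) (hS : ηr * (m * C) * S ≤ δ / 2)
    (hν : ν * m ≤ ((Finset.univ.filter fun r => 0 ≤ U 0 r o).card : ℝ))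
    (hgrow : C ≤ ν * (ηe * g * ∑ i ∈ Finset.range S, avg (e i))) :
    ∀ t ≤ T, ∀ q, q ≠ o → q ≠ o' → W t q - W t o ≤ W 0 q - W 0 o + δ := by
  have early : ∀ t ≤ S, ∀ q, q ≠ o → q ≠ o' → W t q - W t o ≤ W 0 q - W 0 o + δ := by
    intro t ht q hq hq'
    have h1 := h.router_irrelevant_le (ht.trans hST) hq hq'
    have h2 := h.router_main_ge (ht.trans hST)
    have h3 : ηr * (m * C) * t ≤ ηr * (m * C) * S := by
      have := mul_nonneg h.router_rate_nonneg h.mC_nonneg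
      gcongr
    linarith
  -- There is no circularity: up to time `S` the order is kept by the crude bound on the loss, and
  -- this alone feeds the neurons until `o` dominates. From then on the router coordinate along `o`
  -- cannot decrease.
  have hact : m * C ≤ activation (U S) o := by
    refine le_trans ?_ (h.activation_main_ge hg
      (fun t ht b => hgate t (ht.trans_le hST) b (early t ht.le)) he0 hν)
    nlinarith [Nat.cast_nonneg (α := ℝ) m]
  intro t ht q hq hq'
  rcases le_total t S with hts | hts
  · exact early t hts q hq hq'
  · have h1 := h.router_irrelevant_le ht hq hq'
    have h2 := h.router_main_ge hST
    have h3 := h.router_main_mono hts ht hact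
    linarith

/-- Exponential of the router coordinate that an expert reaches if its marked slots feed it during
the whole training. -/
theorem exp_router_ge_of_fed {e : ℕ → Fin B → ℝ} {g c ν Y : ℝ} {S : ℕ} (hST : S ≤ T) (hg : 0 ≤ g)
    (hc : 0 ≤ c) (hY : 0 ≤ Y) (he0 : ∀ t b, e t b = 0 ∨ e t b = 1)
    (hfed : ∀ t < T, ∀ b, g * e t b ≤ Γ t b o)
    (hcomp : ∀ t < T, ∀ b, c * Γ t b o ≤ Real.exp (W t o) * (1 - Γ t b o))
    (hν : ν * m ≤ ((Finset.univ.filter fun r => 0 ≤ U 0 r o).card : ℝ))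
    (hgrow : m * C + Y ≤ ν * m * (ηe * g * ∑ i ∈ Finset.range S, avg (e i))) :
    ηr * Y * (c * g ^ 2) * ∑ i ∈ Finset.Ico S T, avg (e i) ≤ Real.exp (W T o) := by
  refine h.exp_router_main_ge hST hY (hgrow.trans (h.activation_main_ge hg
    (fun t ht => hfed t (ht.trans_le hST)) (fun t b => ?_) hν)) fun t ht b => ?_
  · rcases he0 t b with h0 | h0 <;> simp [h0]
  · have h1 := hfed t ht b
    have h2 := hcomp t ht b
    have h3 := h.gate_nonneg t b o
    rcases he0 t b with h0 | h0
    · rw [h0, mul_zero]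
      have := mul_nonneg h3 ((mul_nonneg hc h3).trans h2)
      linarith
    · rw [h0, mul_one] at h1 ⊢
      -- On a marked slot, `exp W * Γ(1 - Γ) ≥ c * Γ² ≥ c * g²`.
      have : c * g ^ 2 ≤ c * (Γ t b o) ^ 2 := by gcongr
      nlinarith

end IsControlledRun

/-! ### Top selections and gating values -/

theorem IsTopSelector.mem_of_card_lt {n l : ℕ} {sel : (Fin n → ℝ) → Finset (Fin n)}
    (hsel : IsTopSelector n l sel) {g : Fin n → ℝ} {j : Fin n}
    (h : ((Finset.univ.erase j).filter fun i => g j ≤ g i).card < l) : j ∈ sel g := by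
  by_contra hj
  have : sel g ⊆ (Finset.univ.erase j).filter fun i => g j ≤ g i := fun i hi =>
    Finset.mem_filter.2 ⟨Finset.mem_erase.2 ⟨by rintro rfl; exact hj hi, Finset.mem_univ _⟩,
      (hsel g).2 i hi j hj⟩
  have := Finset.card_le_card this
  rw [(hsel g).1] at this
  omega

/-- Whoever is at least level with `j` under `g'` was strictly above it under `g`, hence was chosen
together with `j`. So there are at most `l - 1` such rivals, whatever the tie-breaking. -/
theorem IsTopSelector.mem_of_mem {n l : ℕ} {sel : (Fin n → ℝ) → Finset (Fin n)}
    (hsel : IsTopSelector n l sel) {g g' : Fin n → ℝ} {j : Fin n} (hj : j ∈ sel g)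
    (h : ∀ i, i ≠ j → g' j ≤ g' i → g j < g i) : j ∈ sel g' := by
  refine hsel.mem_of_card_lt ?_
  have hsub : (Finset.univ.erase j).filter (fun i => g' j ≤ g' i) ⊆ (sel g).erase j := by
    intro i hi
    obtain ⟨h1, h2⟩ := Finset.mem_filter.1 hi
    have hij := Finset.ne_of_mem_erase h1
    refine Finset.mem_erase.2 ⟨hij, ?_⟩
    by_contra hn
    exact absurd (h i hij h2) (not_lt.2 ((hsel g).2 j hj i hn))
  have h1 := Finset.card_le_card hsub
  have h2 := Finset.card_erase_lt_of_mem hj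
  rw [(hsel g).1] at h2
  omega

section Gate
variable {n d m k l : ℕ} {sel : (Fin n → ℝ) → Finset (Fin n)} (hsel : IsTopSelector n l sel)
  (hl : 0 < l) (θ : Weights d m k) (s : Fin k) (x : Fin n → Vec d)

theorem gate_nonneg (sel : (Fin n → ℝ) → Finset (Fin n)) (j : Fin n) : 0 ≤ gate sel θ s x j := by
  unfold gate
  split_ifs <;> positivity

include hsel hl in
theorem sum_chosen_gate : ∑ j ∈ chosen sel θ s x, gate sel θ s x j = 1 := by
  have hne : (chosen sel θ s x).Nonempty := by
    rw [← Finset.card_pos, chosen, (hsel _).1]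
    exact hl
  have hpos : 0 < ∑ i ∈ chosen sel θ s x, Real.exp (routing θ s x i) :=
    Finset.sum_pos (fun _ _ => Real.exp_pos _) hne
  rw [Finset.sum_congr rfl fun j hj => by rw [gate, if_pos hj], ← Finset.sum_div,
    div_self hpos.ne']

theorem sum_chosen_gate_mul (sel : (Fin n → ℝ) → Finset (Fin n)) (f : Fin n → ℝ) :
    ∑ j ∈ chosen sel θ s x, gate sel θ s x j * f j = ∑ j, gate sel θ s x j * f j := by
  refine Finset.sum_subset (Finset.subset_univ _) fun j _ hj => ?_
  rw [gate, if_neg hj, zero_mul]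

include hsel hl in
theorem sum_gate : ∑ j, gate sel θ s x j = 1 := by
  rw [← sum_chosen_gate hsel hl θ s x]
  simpa using (sum_chosen_gate_mul θ s x sel fun _ => 1).symm

/-- Total exponential routing value of the other chosen tokens. -/
def rivalMass (sel : (Fin n → ℝ) → Finset (Fin n)) (θ : Weights d m k) (s : Fin k)
    (x : Fin n → Vec d) (j : Fin n) : ℝ :=
  ∑ i ∈ (chosen sel θ s x).erase j, Real.exp (routing θ s x i)

theorem rivalMass_nonneg (sel : (Fin n → ℝ) → Finset (Fin n)) (j : Fin n) :
    0 ≤ rivalMass sel θ s x j := Finset.sum_nonneg fun _ _ => (Real.exp_pos _).le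

variable {θ s x}

theorem gate_eq_of_mem {j : Fin n} (hj : j ∈ chosen sel θ s x) :
    gate sel θ s x j =
      Real.exp (routing θ s x j) / (Real.exp (routing θ s x j) + rivalMass sel θ s x j) := by
  rw [gate, if_pos hj, ← Finset.add_sum_erase _ _ hj, rivalMass]

/-- With `E` the exponential routing value of `j` and `M` the rival mass, both sides equal `E * M /
(E + M)`. This trades the saturation factor for a mass that is bounded in terms of the other tokens
only. -/
theorem exp_routing_mul_one_sub_gate {j : Fin n} (hj : j ∈ chosen sel θ s x) :
    Real.exp (routing θ s x j) * (1 - gate sel θ s x j) =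
      rivalMass sel θ s x j * gate sel θ s x j := by
  have h1 := Real.exp_pos (routing θ s x j)
  have h2 := rivalMass_nonneg θ s x sel j
  rw [gate_eq_of_mem hj]
  field_simp
  ring

include hsel in
theorem rivalMass_le {j : Fin n} {X : ℝ} (hX : ∀ i ≠ j, routing θ s x i ≤ X) :
    rivalMass sel θ s x j ≤ l * Real.exp X := by
  calc rivalMass sel θ s x j ≤ ∑ _i ∈ (chosen sel θ s x).erase j, Real.exp X :=
        Finset.sum_le_sum fun i hi => Real.exp_le_exp.2 (hX i (Finset.ne_of_mem_erase hi))
    _ = ((chosen sel θ s x).erase j).card * Real.exp X := by simp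
    _ ≤ l * Real.exp X := by
        gcongr
        exact_mod_cast (Finset.card_erase_le.trans ((hsel _).1).le)

include hsel in
theorem le_rivalMass (hl2 : 2 ≤ l) {j : Fin n} {X : ℝ} (hX : ∀ i ≠ j, X ≤ routing θ s x i) :
    Real.exp X ≤ rivalMass sel θ s x j := by
  have hc : 1 ≤ ((chosen sel θ s x).erase j).card := by
    have := Finset.pred_card_le_card_erase (s := chosen sel θ s x) (a := j)
    rw [chosen, (hsel _).1] at this
    rw [chosen]
    omega
  obtain ⟨i, hi⟩ := Finset.card_pos.1 hc
  exact (Real.exp_le_exp.2 (hX i (Finset.ne_of_mem_erase hi))).trans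
    (Finset.single_le_sum (f := fun i => Real.exp (routing θ s x i))
      (fun i _ => (Real.exp_pos _).le) hi)

include hsel in
theorem gate_ge_of_routing_le {j : Fin n} {X : ℝ} (hX0 : 0 ≤ X) (hj : j ∈ chosen sel θ s x)
    (hX : ∀ i ≠ j, routing θ s x i ≤ routing θ s x j + X) :
    1 / (l * Real.exp X) ≤ gate sel θ s x j := by
  have h1 := Real.exp_pos (routing θ s x j)
  have hsum : ∑ i ∈ chosen sel θ s x, Real.exp (routing θ s x i) ≤
      l * Real.exp X * Real.exp (routing θ s x j) := by
    calc ∑ i ∈ chosen sel θ s x, Real.exp (routing θ s x i)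
        ≤ ∑ _i ∈ chosen sel θ s x, Real.exp (routing θ s x j + X) := by
          refine Finset.sum_le_sum fun i _ => Real.exp_le_exp.2 ?_
          by_cases hij : i = j
          · subst hij; linarith
          · exact hX i hij
      _ = l * Real.exp X * Real.exp (routing θ s x j) := by
          rw [Finset.sum_const, nsmul_eq_mul, chosen, (hsel _).1, Real.exp_add]; ring
  have hl : 0 < l := by
    rw [← (hsel (routing θ s x)).1]
    exact Finset.card_pos.2 ⟨j, hj⟩
  have hpos : 0 < ∑ i ∈ chosen sel θ s x, Real.exp (routing θ s x i) :=
    Finset.sum_pos (fun _ _ => Real.exp_pos _) ⟨j, hj⟩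
  rw [gate, if_pos hj, div_le_div_iff₀ (by positivity) hpos]
  linarith

end Gate

/-! ### Gating values of patterns -/

section Pattern
variable {n d m k l : ℕ} {sel : (Fin n → ℝ) → Finset (Fin n)} {P : Fin d → Vec d}

/-- Total gating value of the tokens equal to the pattern `p`. -/
def patternGate (sel : (Fin n → ℝ) → Finset (Fin n)) (P : Fin d → Vec d) (θ : Weights d m k)
    (s : Fin k) (z : Sample n d) (p : Fin d) : ℝ :=
  ∑ j, if z.1 j = p then gate sel θ s (tokens P z) j else 0

theorem patternGate_nonneg (θ : Weights d m k) (s : Fin k) (z : Sample n d) (p : Fin d) :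
    0 ≤ patternGate sel P θ s z p :=
  Finset.sum_nonneg fun j _ => by split_ifs <;> simp [gate_nonneg]

theorem sum_patternGate_mul (θ : Weights d m k) (s : Fin k) (z : Sample n d) (f : Fin d → ℝ) :
    ∑ p, patternGate sel P θ s z p * f p = ∑ j, gate sel θ s (tokens P z) j * f (z.1 j) := by
  simp only [patternGate, Finset.sum_mul]
  rw [Finset.sum_comm]
  refine Finset.sum_congr rfl fun j _ => ?_
  simp [ite_mul]

theorem sum_patternGate (hsel : IsTopSelector n l sel) (hl : 0 < l) (θ : Weights d m k)
    (s : Fin k) (z : Sample n d) : ∑ p, patternGate sel P θ s z p = 1 := by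
  have := sum_patternGate_mul (sel := sel) (P := P) θ s z fun _ => 1
  simpa [sum_gate hsel hl] using this

theorem patternGate_le_one (hsel : IsTopSelector n l sel) (hl : 0 < l) (θ : Weights d m k)
    (s : Fin k) (z : Sample n d) (p : Fin d) : patternGate sel P θ s z p ≤ 1 := by
  rw [← sum_patternGate hsel hl θ s z]
  exact Finset.single_le_sum (fun q _ => patternGate_nonneg θ s z q) (Finset.mem_univ p)

theorem patternGate_eq_zero (θ : Weights d m k) (s : Fin k) {z : Sample n d} {p : Fin d}
    (hp : ∀ j, z.1 j ≠ p) : patternGate sel P θ s z p = 0 :=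
  Finset.sum_eq_zero fun j _ => if_neg (hp j)

theorem patternGate_eq_gate (θ : Weights d m k) (s : Fin k) {z : Sample n d} {j : Fin n}
    (hj : ∀ i ≠ j, z.1 i ≠ z.1 j) :
    patternGate sel P θ s z (z.1 j) = gate sel θ s (tokens P z) j := by
  rw [patternGate, Finset.sum_eq_single j]
  · simp
  · intro i _ hi
    exact if_neg (hj i hi)
  · simp

/-! ### Gradients in the coordinates of the patterns -/

theorem inner_pattern (hP : Orthonormal ℝ P) (p q : Fin d) :
    inner ℝ (P p) (P q) = if p = q then (1 : ℝ) else 0 := orthonormal_iff_ite.1 hP p q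

theorem inner_neuronGrad (hP : Orthonormal ℝ P) (a : Fin k → ℤˣ) (θ : Weights d m k) (s : Fin k)
    (r : Fin m) (z : Sample n d) (p : Fin d) :
    inner ℝ (neuronGrad sel a θ s r (tokens P z) z.2) (P p) = -((sgn z.2 * sgn (a s)) *
      if 0 ≤ inner ℝ (θ.neuron s r) (P p) then patternGate sel P θ s z p else 0) := by
  rw [neuronGrad, inner_smul_left, sum_inner]
  simp only [inner_smul_left, tokens, inner_pattern hP, conj_trivial, neg_mul, neg_inj]
  congr 1
  simp only [mul_assoc]
  have h1 := sum_chosen_gate_mul θ s (tokens P z) sel fun j =>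
    ((if 0 ≤ inner ℝ (θ.neuron s r) (P (z.1 j)) then (1 : ℝ) else 0) *
      if z.1 j = p then 1 else 0)
  refine h1.trans ?_
  rw [patternGate]
  split_ifs with hp
  · refine Finset.sum_congr rfl fun j _ => ?_
    by_cases hj : z.1 j = p
    · simp [hj, hp]
    · simp [hj]
  · refine Finset.sum_eq_zero fun j _ => ?_
    by_cases hj : z.1 j = p
    · simp [hj, hp]
    · simp [hj]

/-- The term `i = j` of the inner sum vanishes and the gating values add up to `1`, so the inner sum
is `x_j` minus the gated mean of the tokens. Up to sign, the gradient is the covariance of token and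
activation under the gating distribution. -/
theorem inner_routerGrad (hP : Orthonormal ℝ P) (hsel : IsTopSelector n l sel) (hl : 0 < l)
    (a : Fin k → ℤˣ) (θ : Weights d m k) (s : Fin k)
    (z : Sample n d) (p : Fin d) :
    inner ℝ (routerGrad sel a θ s (tokens P z) z.2) (P p) = -((sgn z.2 * sgn (a s)) *
      (patternGate sel P θ s z p *
        (hidden θ s (P p) - ∑ q, patternGate sel P θ s z q * hidden θ s (P q)))) := by
  set G := gate sel θ s (tokens P z) with hG
  set J := chosen sel θ s (tokens P z) with hJ
  have hsum : ∑ i ∈ J, G i = 1 := sum_chosen_gate hsel hl θ s _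
  have hpg : ∑ i ∈ J, G i * (if z.1 i = p then (1 : ℝ) else 0) = patternGate sel P θ s z p := by
    rw [hJ, hG, sum_chosen_gate_mul, patternGate]
    simp
  have hmean : ∑ q, patternGate sel P θ s z q * hidden θ s (P q) =
      ∑ j ∈ J, G j * hidden θ s (P (z.1 j)) := by
    rw [sum_patternGate_mul θ s z fun q => hidden θ s (P q), hJ, hG, sum_chosen_gate_mul]
  rw [routerGrad, inner_smul_left, sum_inner]
  simp only [inner_smul_left, conj_trivial, neg_mul, neg_inj]
  congr 1
  have inner1 : ∀ j ∈ J, inner ℝ (∑ i ∈ J.erase j, G i • (tokens P z j - tokens P z i)) (P p) =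
      (if z.1 j = p then (1 : ℝ) else 0) - patternGate sel P θ s z p := by
    intro j hj
    have h0 : ∑ i ∈ J.erase j, G i • (tokens P z j - tokens P z i) =
        ∑ i ∈ J, G i • (tokens P z j - tokens P z i) := by
      rw [← Finset.add_sum_erase _ _ hj]
      simp
    rw [h0, sum_inner]
    simp only [inner_smul_left, inner_sub_left, tokens, inner_pattern hP, conj_trivial, mul_sub,
      Finset.sum_sub_distrib, ← Finset.sum_mul, hsum, one_mul, hpg]
  rw [Finset.sum_congr rfl fun j hj => by rw [inner1 j hj], hmean]
  have h3 : ∑ j ∈ J, G j * hidden θ s (P (z.1 j)) * (if z.1 j = p then (1 : ℝ) else 0) =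
      patternGate sel P θ s z p * hidden θ s (P p) := by
    rw [← hpg, Finset.sum_mul]
    refine Finset.sum_congr rfl fun j _ => ?_
    by_cases hj : z.1 j = p
    · simp [hj]
    · simp [hj]
  have h4 : ∀ j, hidden θ s (tokens P z j) * G j *
      ((if z.1 j = p then (1 : ℝ) else 0) - patternGate sel P θ s z p) =
      G j * hidden θ s (P (z.1 j)) * (if z.1 j = p then (1 : ℝ) else 0) -
      patternGate sel P θ s z p * (G j * hidden θ s (P (z.1 j))) := by
    intro j
    rw [tokens]
    ring
  refine (Finset.sum_congr rfl fun j _ => h4 j).trans ?_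
  rw [Finset.sum_sub_distrib, h3, ← Finset.mul_sum]
  ring

end Pattern

/-! ### Gating of the task-specific pattern in valid samples -/

theorem sgn_mul_self (c : ℤˣ) : sgn c * sgn c = 1 := by
  rcases Int.units_eq_one_or c with rfl | rfl <;> simp [sgn]

theorem sgn_mul_of_ne {c c' : ℤˣ} (h : c ≠ c') : sgn c * sgn c' = -1 := by
  rcases Int.units_eq_one_or c with rfl | rfl <;> rcases Int.units_eq_one_or c' with rfl | rfl <;>
    simp_all [sgn]

/-- Exactly one token is task-specific, and it is the one of the label. -/
def IsValid {n d : ℕ} (o : ℤˣ → Fin d) (z : Sample n d) : Prop :=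
  ∃ j, z.1 j = o z.2 ∧ ∀ i, i ≠ j → z.1 i ∉ Set.range o

/-- The samples that contain the pattern `q`. -/
def containing (n : ℕ) {d : ℕ} (q : Fin d) : Set (Sample n d) := {z | ∃ j, z.1 j = q}

/-- The samples of class `c` whose task-specific token is chosen by expert `s`. -/
def choosing {n d m k : ℕ} (sel : (Fin n → ℝ) → Finset (Fin n)) (P : Fin d → Vec d)
    (o : ℤˣ → Fin d) (θ : Weights d m k) (c : ℤˣ) (s : Fin k) : Set (Sample n d) :=
  {z | z.2 = c ∧ ∃ j ∈ chosen sel θ s (tokens P z), z.1 j = o c}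

section Sample
variable {n d m k l : ℕ} {sel : (Fin n → ℝ) → Finset (Fin n)} {P : Fin d → Vec d}
  {o : ℤˣ → Fin d} {z : Sample n d} {c : ℤˣ} {s : Fin k}

theorem IsValid.exists_main (hz : IsValid o z) (hc : z.2 = c) :
    ∃ j, z.1 j = o c ∧ ∀ i ≠ j, z.1 i ≠ o c ∧ z.1 i ≠ o (-c) := by
  obtain ⟨j, hj, h⟩ := hz
  exact ⟨j, hc ▸ hj, fun i hi => ⟨fun h' => h i hi ⟨c, h'.symm⟩, fun h' => h i hi ⟨-c, h'.symm⟩⟩⟩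

theorem IsValid.ne_of_ne (ho : Function.Injective o) (hz : IsValid o z) (hc : z.2 ≠ c)
    (j : Fin n) : z.1 j ≠ o c := by
  obtain ⟨i, hi, h⟩ := hz
  by_cases hij : j = i
  · subst hij
    rw [hi]
    exact fun h' => hc (ho h')
  · exact fun h' => h j hij ⟨c, h'.symm⟩

theorem patternGate_main_of_ne (ho : Function.Injective o) (θ : Weights d m k)
    (hz : IsValid o z) (hc : z.2 ≠ c) : patternGate sel P θ s z (o c) = 0 :=
  patternGate_eq_zero θ s (hz.ne_of_ne ho hc)

/-- Either the task-specific pattern of class `c` is not chosen, or its gating value is that of the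
only token where it stands. -/
theorem patternGate_main_cases (ho : Function.Injective o) (θ : Weights d m k)
    (hz : IsValid o z) (c : ℤˣ) (s : Fin k) :
    patternGate sel P θ s z (o c) = 0 ∨ ∃ j ∈ chosen sel θ s (tokens P z), z.1 j = o c ∧
      patternGate sel P θ s z (o c) = gate sel θ s (tokens P z) j ∧
      ∀ i ≠ j, z.1 i ≠ o c ∧ z.1 i ≠ o (-c) := by
  by_cases hc : z.2 = c
  · obtain ⟨j, hj, h⟩ := hz.exists_main hc
    have hg : patternGate sel P θ s z (o c) = gate sel θ s (tokens P z) j := by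
      rw [← hj]
      exact patternGate_eq_gate θ s fun i hi => hj ▸ (h i hi).1
    by_cases hm : j ∈ chosen sel θ s (tokens P z)
    · exact Or.inr ⟨j, hm, hj, hg, h⟩
    · left
      rw [hg, gate, if_neg hm]
  · exact Or.inl (patternGate_main_of_ne ho θ hz hc)

/-- The left side is the rival mass times `Γ²`, and the rivals are at most `l` tokens with
irrelevant patterns, since the task-specific token is unique. -/
theorem exp_mul_gate_mul_one_sub_le (hsel : IsTopSelector n l sel) (hl : 0 < l)
    (ho : Function.Injective o) (θ : Weights d m k) (hz : IsValid o z) {X : ℝ}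
    (hX : ∀ q, q ≠ o c → q ≠ o (-c) → inner ℝ (θ.router s) (P q) ≤ X) :
    Real.exp (inner ℝ (θ.router s) (P (o c))) *
      (patternGate sel P θ s z (o c) * (1 - patternGate sel P θ s z (o c))) ≤
      l * Real.exp X := by
  rcases patternGate_main_cases (sel := sel) (P := P) ho θ hz c s with h0 | ⟨j, hj, hjo, hg, hi⟩
  · rw [h0, zero_mul, mul_zero]
    positivity
  · have h1 := exp_routing_mul_one_sub_gate hj
    have h2 := rivalMass_le hsel (θ := θ) (s := s) (x := tokens P z) (j := j) (X := X)
      fun i hij => hX _ (hi i hij).1 (hi i hij).2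
    have h3 : routing θ s (tokens P z) j = inner ℝ (θ.router s) (P (o c)) := by
      rw [routing, tokens, hjo]
    have h4 := patternGate_le_one (P := P) hsel hl θ s z (o c)
    have h5 := patternGate_nonneg (sel := sel) (P := P) θ s z (o c)
    have h6 := rivalMass_nonneg θ s (tokens P z) sel j
    rw [h3, ← hg] at h1
    set G := patternGate sel P θ s z (o c)
    calc _ = G * (rivalMass sel θ s (tokens P z) j * G) := by rw [← h1]; ring
      _ ≤ rivalMass sel θ s (tokens P z) j := by nlinarith [mul_nonneg h5 h6]
      _ ≤ _ := h2

/-- The rival mass cannot vanish: as `l ≥ 2`, at least one other token is chosen, and it carries an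
irrelevant pattern. -/
theorem mul_gate_le_exp_mul_one_sub (hsel : IsTopSelector n l sel) (hl : 2 ≤ l)
    (ho : Function.Injective o) (θ : Weights d m k) (hz : IsValid o z) {X : ℝ}
    (hX : ∀ q, q ≠ o c → q ≠ o (-c) → X ≤ inner ℝ (θ.router s) (P q)) :
    Real.exp X * patternGate sel P θ s z (o c) ≤
      Real.exp (inner ℝ (θ.router s) (P (o c))) * (1 - patternGate sel P θ s z (o c)) := by
  rcases patternGate_main_cases (sel := sel) (P := P) ho θ hz c s with h0 | ⟨j, hj, hjo, hg, hi⟩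
  · rw [h0, sub_zero, mul_zero, mul_one]
    positivity
  · have h1 := exp_routing_mul_one_sub_gate hj
    have h2 := le_rivalMass hsel hl (θ := θ) (s := s) (x := tokens P z) (j := j) (X := X)
      fun i hij => hX _ (hi i hij).1 (hi i hij).2
    have h3 : routing θ s (tokens P z) j = inner ℝ (θ.router s) (P (o c)) := by
      rw [routing, tokens, hjo]
    rw [h3, ← hg] at h1
    rw [h1]
    exact mul_le_mul_of_nonneg_right h2 (patternGate_nonneg θ s z _)

/-- An expert goes on choosing the task-specific token, with a gating value bounded below, as long
as the irrelevant patterns gain little on it. -/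
theorem patternGate_ge_of_order (hsel : IsTopSelector n l sel)
    {θ₀ θ : Weights d m k} (hz : IsValid o z) (hc : z ∈ choosing sel P o θ₀ c s)
    {δ X : ℝ} (hδ : 0 < δ) (hX0 : 0 ≤ X)
    (hX : ∀ p q, inner ℝ (θ₀.router s) (P p) ≤ inner ℝ (θ₀.router s) (P q) + (X - δ))
    (hsep : ∀ q, q ≠ o c → q ≠ o (-c) →
      2 * δ ≤ |inner ℝ (θ₀.router s) (P (o c)) - inner ℝ (θ₀.router s) (P q)|)
    (hord : ∀ q, q ≠ o c → q ≠ o (-c) →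
      inner ℝ (θ.router s) (P q) - inner ℝ (θ.router s) (P (o c)) ≤
        inner ℝ (θ₀.router s) (P q) - inner ℝ (θ₀.router s) (P (o c)) + δ) :
    1 / (l * Real.exp X) ≤ patternGate sel P θ s z (o c) := by
  obtain ⟨hzc, j, hj, hjo⟩ := hc
  obtain ⟨j', hj', hother⟩ := hz.exists_main hzc
  obtain rfl : j = j' := by
    by_contra hne
    exact (hother j hne).1 hjo
  have hg : patternGate sel P θ s z (o c) = gate sel θ s (tokens P z) j := by
    rw [← hjo]
    exact patternGate_eq_gate θ s fun i hi => hjo ▸ (hother i hi).1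
  rw [hg]
  have hmem : j ∈ chosen sel θ s (tokens P z) := by
    -- A pattern that started below `o c` was below by at least `2 * δ` and has gained at most `δ`,
    -- so it is still strictly below. Any present rival was therefore strictly above at the start.
    refine hsel.mem_of_mem hj fun i hij hle => ?_
    simp only [routing, tokens, hjo] at hle ⊢
    have h1 := hord _ (hother i hij).1 (hother i hij).2
    have h2 := hsep _ (hother i hij).1 (hother i hij).2
    rcases le_abs.1 h2 with h3 | h3 <;> linarith
  refine gate_ge_of_routing_le hsel hX0 hmem fun i hij => ?_
  simp only [routing, tokens, hjo]
  have h1 := hord _ (hother i hij).1 (hother i hij).2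
  have h2 := hX (z.1 i) (o c)
  linarith

/-- A router that ranks the task-specific pattern first gives it a gating value of at least
`1 / l`. -/
theorem patternGate_ge_of_top (hsel : IsTopSelector n l sel) (hl : 0 < l)
    {θ : Weights d m k} (hz : IsValid o z) (hc : z.2 = c)
    (htop : ∀ q, q ≠ o c → q ≠ o (-c) →
      inner ℝ (θ.router s) (P q) < inner ℝ (θ.router s) (P (o c))) :
    1 / (l : ℝ) ≤ patternGate sel P θ s z (o c) := by
  obtain ⟨j, hjo, hother⟩ := hz.exists_main hc
  have hg : patternGate sel P θ s z (o c) = gate sel θ s (tokens P z) j := by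
    rw [← hjo]
    exact patternGate_eq_gate θ s fun i hi => hjo ▸ (hother i hi).1
  have hlt : ∀ i ≠ j, routing θ s (tokens P z) i < routing θ s (tokens P z) j := by
    intro i hij
    simp only [routing, tokens, hjo]
    exact htop _ (hother i hij).1 (hother i hij).2
  have hmem : j ∈ chosen sel θ s (tokens P z) := by
    refine hsel.mem_of_card_lt ?_
    rw [Finset.filter_false_of_mem fun i hi => not_le.2 (hlt i (Finset.ne_of_mem_erase hi))]
    simpa using hl
  rw [hg]
  have := gate_ge_of_routing_le hsel le_rfl hmem fun i hij => by
    rw [add_zero]; exact (hlt i hij).le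
  simpa using this

end Sample

/-! ### SGD as an expert run -/

section Run
variable {n d m k l B : ℕ} {sel : (Fin n → ℝ) → Finset (Fin n)} {P : Fin d → Vec d}
  {o : ℤˣ → Fin d} {a : Fin k → ℤˣ} {ηe ηr : ℝ} {zs : ℕ → Fin B → Sample n d}
  {θ₀ : Weights d m k}

/-- By linearity of the loss in the output, the gradient in one expert does not involve the weights
of the others, so the training decouples. -/
theorem sgd_isExpertRun (hsel : IsTopSelector n l sel) (hl : 0 < l) (hP : Orthonormal ℝ P)
    (ho : Function.Injective o) (hzs : ∀ t b, IsValid o (zs t b)) (hB : 0 < B) (hηe : 0 ≤ ηe)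
    (hηr : 0 ≤ ηr) (s : Fin k) :
    IsExpertRun (o (a s)) (o (-a s)) ηe ηr
      (fun t r p => inner ℝ ((sgd sel P a ηe ηr zs θ₀ t).neuron s r) (P p))
      (fun t p => inner ℝ ((sgd sel P a ηe ηr zs θ₀ t).router s) (P p))
      (fun t b => sgn (zs t b).2 * sgn (a s))
      (fun t b p => patternGate sel P (sgd sel P a ηe ηr zs θ₀ t) s (zs t b) p)
      (fun t b q => (containing n q).indicator 1 (zs t b)) where
  neuron_step t r p := by
    rw [sgd, sgdStep, inner_sub_left, inner_smul_left, inner_smul_left, sum_inner]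
    simp only [conj_trivial, inner_neuronGrad hP, avg, Finset.sum_neg_distrib]
    ring
  router_step t p := by
    rw [sgd, sgdStep, inner_sub_left, inner_smul_left, inner_smul_left, sum_inner]
    simp only [conj_trivial, inner_routerGrad hP hsel hl, avg, Finset.sum_neg_distrib]
    simp only [meanActivation, activation, hidden]
    ring
  gate_nonneg t b p := patternGate_nonneg _ _ _ _
  gate_sum t b := sum_patternGate hsel hl _ _ _
  gate_le_occ t b p := by
    by_cases hp : zs t b ∈ containing n p
    · simpa [hp] using patternGate_le_one hsel hl _ _ _ _
    · rw [Set.indicator_of_notMem hp]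
      exact (patternGate_eq_zero _ _ fun j hj => hp ⟨j, hj⟩).le
  label t b := by
    by_cases hc : (zs t b).2 = a s
    · left
      rw [hc]
      refine ⟨sgn_mul_self _, patternGate_main_of_ne ho _ (hzs t b) ?_⟩
      rw [hc]
      exact (neg_units_ne_self _).symm
    · exact Or.inr ⟨sgn_mul_of_ne hc, patternGate_main_of_ne ho _ (hzs t b) hc⟩
  batch_pos := hB
  expert_rate_nonneg := hηe
  router_rate_nonneg := hηr

/-- The patterns form an orthonormal basis. The many small coordinates add up in squares and so cost
only a factor `√d`. -/
theorem norm_le_of_coordinates (hP : Orthonormal ℝ P) (v : Vec d) {p p' : Fin d} {x y w : ℝ}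
    (hpp : p ≠ p') (hx : |inner ℝ v (P p)| ≤ x) (hy : |inner ℝ v (P p')| ≤ y) (hw : 0 ≤ w)
    (hq : ∀ q, q ≠ p → q ≠ p' → |inner ℝ v (P q)| ≤ w) : ‖v‖ ≤ x + y + Real.sqrt d * w := by
  have hspan : ⊤ ≤ Submodule.span ℝ (Set.range P) := by
    rw [hP.linearIndependent.span_eq_top_of_card_eq_finrank' (by simp)]
  have hnorm : ‖v‖ ^ 2 = ∑ q, |inner ℝ v (P q)| ^ 2 := by
    rw [← (OrthonormalBasis.mk hP hspan).sum_sq_norm_inner_left v]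
    simp
  have hx0 := (abs_nonneg _).trans hx
  have hy0 := (abs_nonneg _).trans hy
  have hd : Real.sqrt d ^ 2 = d := Real.sq_sqrt (by positivity)
  refine abs_le_of_sq_le_sq' ?_ (by positivity) |>.2
  rw [hnorm, ← Finset.add_sum_erase _ _ (Finset.mem_univ p),
    ← Finset.add_sum_erase _ _ (Finset.mem_erase.2 ⟨hpp.symm, Finset.mem_univ p'⟩)]
  have h1 : ∑ q ∈ (Finset.univ.erase p).erase p', |inner ℝ v (P q)| ^ 2 ≤ d * w ^ 2 := by
    calc _ ≤ ∑ _q ∈ (Finset.univ.erase p).erase p', w ^ 2 := by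
          refine Finset.sum_le_sum fun q hq' => ?_
          have := hq q (Finset.ne_of_mem_erase (Finset.mem_of_mem_erase hq'))
            (Finset.ne_of_mem_erase hq')
          gcongr
      _ = ((Finset.univ.erase p).erase p').card * w ^ 2 := by simp
      _ ≤ d * w ^ 2 := by
          gcongr
          have := Finset.card_le_univ ((Finset.univ.erase p).erase p')
          simpa using this
  have h2 : |inner ℝ v (P p)| ^ 2 ≤ x ^ 2 := by gcongr
  have h3 : |inner ℝ v (P p')| ^ 2 ≤ y ^ 2 := by gcongr
  have h4 := mul_nonneg hx0 hy0
  have h5 := mul_nonneg (Real.sqrt_nonneg d) hw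
  nlinarith [mul_nonneg hx0 h5, mul_nonneg hy0 h5]

end Run

/-! ### Comparison of experts through the change of the router norm -/

section Compare
variable {n d m k l B : ℕ} {sel : (Fin n → ℝ) → Finset (Fin n)} {P : Fin d → Vec d}
  {o : ℤˣ → Fin d} {a : Fin k → ℤˣ} {ηe ηr : ℝ} {zs : ℕ → Fin B → Sample n d}
  {θ₀ : Weights d m k}

/-- The evolution of expert `s` under SGD on the batches `zs`, up to time `T`. -/
abbrev IsControlledSGD (sel : (Fin n → ℝ) → Finset (Fin n)) (P : Fin d → Vec d)
    (o : ℤˣ → Fin d) (a : Fin k → ℤˣ) (ηe ηr : ℝ) (zs : ℕ → Fin B → Sample n d)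
    (θ₀ : Weights d m k) (C ε : ℝ) (T : ℕ) (s : Fin k) : Prop :=
  IsControlledRun (o (a s)) (o (-a s)) ηe ηr
    (fun t r p => inner ℝ ((sgd sel P a ηe ηr zs θ₀ t).neuron s r) (P p))
    (fun t p => inner ℝ ((sgd sel P a ηe ηr zs θ₀ t).router s) (P p))
    (fun t b => sgn (zs t b).2 * sgn (a s))
    (fun t b p => patternGate sel P (sgd sel P a ηe ηr zs θ₀ t) s (zs t b) p)
    (fun t b q => (containing n q).indicator 1 (zs t b)) C ε T

theorem abs_inner_pattern_le (hP : Orthonormal ℝ P) (v : Vec d) (p : Fin d) :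
    |inner ℝ v (P p)| ≤ ‖v‖ := by
  simpa [hP.1 p] using abs_real_inner_le_norm v (P p)

theorem router_ge_of_abs {C ε Λ : ℝ} {T : ℕ} {s : Fin k} (hP : Orthonormal ℝ P)
    (hrun : IsControlledSGD sel P o a ηe ηr zs θ₀ C ε T s) (hΛ : ‖θ₀.router s‖ ≤ Λ)
    (hdrift : ηr * (m * (C + ηe * T)) * ε ≤ 1) {t : ℕ} (ht : t ≤ T) {q : Fin d}
    (hq : q ≠ o (a s)) (hq' : q ≠ o (-a s)) :
    -(Λ + 1) ≤ inner ℝ ((sgd sel P a ηe ηr zs θ₀ t).router s) (P q) ∧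
      inner ℝ ((sgd sel P a ηe ηr zs θ₀ t).router s) (P q) ≤ Λ + 1 := by
  have h1 := abs_le.1 ((hrun.router_irrelevant_abs ht hq hq').trans hdrift)
  have h2 := abs_le.1 ((abs_inner_pattern_le hP (θ₀.router s) q).trans hΛ)
  simp only [sgd] at h1
  constructor <;> linarith

/-- The router of an important expert grows logarithmically along its task-specific pattern. -/
theorem exp_router_ge_of_important {C ε Λ δ g κ ν Y : ℝ} {T S₀ S₁ : ℕ} {s : Fin k}
    (hsel : IsTopSelector n l sel) (hl : 2 ≤ l) (hP : Orthonormal ℝ P)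
    (ho : Function.Injective o) (hzs : ∀ t b, IsValid o (zs t b))
    (hrun : IsControlledSGD sel P o a ηe ηr zs θ₀ C ε T s) (hΛ : ‖θ₀.router s‖ ≤ Λ)
    (hδ : 0 < δ) (hδ1 : δ ≤ 1) (hν0 : 0 ≤ ν) (hY : 0 ≤ Y)
    (hsep : ∀ q, q ≠ o (a s) → q ≠ o (-a s) →
      2 * δ ≤ |inner ℝ (θ₀.router s) (P (o (a s)) - P q)|)
    (hν : ν * m ≤ ((Finset.univ.filter fun r =>
      0 ≤ inner ℝ (θ₀.neuron s r) (P (o (a s)))).card : ℝ))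
    (hg0 : 0 ≤ g) (hg : g ≤ 1 / (l * Real.exp (2 * Λ + 1)))
    (hS₀ : S₀ ≤ T) (hS₁ : S₁ ≤ T)
    (hwin₀ : κ * S₀ ≤ ∑ t ∈ Finset.range S₀,
      avg fun b => (choosing sel P o θ₀ (a s) s).indicator 1 (zs t b))
    (hwin₁ : κ * S₁ ≤ ∑ t ∈ Finset.range S₁,
      avg fun b => (choosing sel P o θ₀ (a s) s).indicator 1 (zs t b))
    (hwin₂ : κ * (T - S₁) ≤ ∑ t ∈ Finset.Ico S₁ T,
      avg fun b => (choosing sel P o θ₀ (a s) s).indicator 1 (zs t b))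
    (hdrift : ηr * (m * (C + ηe * T)) * ε ≤ 1)
    (hε : ηr * (m * C) * ε ≤ δ / 2) (hearly : ηr * (m * C) * S₀ ≤ δ / 2)
    (hgrow₀ : C ≤ ν * (ηe * g * (κ * S₀)))
    (hgrow₁ : m * C + Y ≤ ν * m * (ηe * g * (κ * S₁))) :
    ηr * Y * (Real.exp (-(Λ + 1)) * g ^ 2) * (κ * (T - S₁)) ≤
      Real.exp (inner ℝ ((sgd sel P a ηe ηr zs θ₀ T).router s) (P (o (a s)))) := by
  have hηe := hrun.expert_rate_nonneg
  have hηr := hrun.router_rate_nonneg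
  have hΛ0 : 0 ≤ Λ := (norm_nonneg _).trans hΛ
  have he : ∀ t b, (choosing sel P o θ₀ (a s) s).indicator (1 : Sample n d → ℝ) (zs t b) = 0 ∨
      (choosing sel P o θ₀ (a s) s).indicator (1 : Sample n d → ℝ) (zs t b) = 1 := by
    intro t b
    by_cases h : zs t b ∈ choosing sel P o θ₀ (a s) s <;> simp [h]
  have hgate : ∀ t < T, ∀ b, (∀ q, q ≠ o (a s) → q ≠ o (-a s) →
      inner ℝ ((sgd sel P a ηe ηr zs θ₀ t).router s) (P q) -
        inner ℝ ((sgd sel P a ηe ηr zs θ₀ t).router s) (P (o (a s))) ≤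
      inner ℝ (θ₀.router s) (P q) - inner ℝ (θ₀.router s) (P (o (a s))) + δ) →
      g * (choosing sel P o θ₀ (a s) s).indicator 1 (zs t b) ≤
        patternGate sel P (sgd sel P a ηe ηr zs θ₀ t) s (zs t b) (o (a s)) := by
    intro t _ b hord
    by_cases h : zs t b ∈ choosing sel P o θ₀ (a s) s
    · rw [Set.indicator_of_mem h, Pi.one_apply, mul_one]
      -- Two initial routing values differ by at most `2 * Λ`, and the order has moved by at most `δ
      -- ≤ 1`; hence the exponent `2 * Λ + 1` in the bound on `g`.
      refine hg.trans <| patternGate_ge_of_order hsel (hzs t b) h hδ (by linarith) (fun p q => ?_)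
        (fun q hq hq' => ?_) hord
      · have h1 := abs_le.1 ((abs_inner_pattern_le hP (θ₀.router s) p).trans hΛ)
        have h2 := abs_le.1 ((abs_inner_pattern_le hP (θ₀.router s) q).trans hΛ)
        linarith
      · rw [← inner_sub_right]
        exact hsep q hq hq'
    · rw [Set.indicator_of_notMem h, mul_zero]
      exact patternGate_nonneg _ _ _ _
  have hmono₀ := mul_le_mul_of_nonneg_left
    (mul_le_mul_of_nonneg_left hwin₀ (mul_nonneg hηe hg0)) hν0
  have hmono₁ := mul_le_mul_of_nonneg_left
    (mul_le_mul_of_nonneg_left hwin₁ (mul_nonneg hηe hg0)) (mul_nonneg hν0 (Nat.cast_nonneg m))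
  have hord := hrun.router_order_preserved hS₀ hg0
    (fun t b => by rcases he t b with h | h <;> rw [h]; exact zero_le_one) hgate hε hearly hν
    (hgrow₀.trans hmono₀)
  refine le_trans ?_ (hrun.exp_router_ge_of_fed hS₁ hg0 (Real.exp_pos (-(Λ + 1))).le hY he
    (fun t ht b => hgate t ht b (hord t ht.le))
    (fun t ht b => mul_gate_le_exp_mul_one_sub hsel hl ho _ (hzs t b) fun q hq hq' =>
      (router_ge_of_abs hP hrun hΛ hdrift ht.le hq hq').1) hν (hgrow₁.trans hmono₁))
  gcongr

/-- An expert whose router has grown no less than that of another one with the same head has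
learned the task-specific pattern as well: its router ranks it first and its neurons have grown
along it. -/
theorem learned_of_normChange_ge {C ε Λ X : ℝ} {T : ℕ} {s s' : Fin k}
    (hsel : IsTopSelector n l sel) (hl : 0 < l) (hP : Orthonormal ℝ P)
    (ho : Function.Injective o) (hzs : ∀ t b, IsValid o (zs t b)) (hss : a s' = a s)
    (hrun : IsControlledSGD sel P o a ηe ηr zs θ₀ C ε T s')
    (hΛ : ‖θ₀.router s‖ ≤ Λ) (hΛ' : ‖θ₀.router s'‖ ≤ Λ)
    (hle : normChange θ₀ (sgd sel P a ηe ηr zs θ₀ T) s ≤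
      normChange θ₀ (sgd sel P a ηe ηr zs θ₀ T) s')
    (hX : X ≤ Real.exp (inner ℝ ((sgd sel P a ηe ηr zs θ₀ T).router s) (P (o (a s)))))
    (hε0 : 0 ≤ ε) (hXlarge : 2 * Real.exp (3 * Λ + 3) < X)
    (hdrift : Real.sqrt d * (ηr * (m * (C + ηe * T)) * ε) ≤ 1 / 2)
    (hopp : ηr * (m * C) * T ≤ 1 / 2)
    (hstep : ηr * (m * (C + ηe * T)) ≤ 1) :
    (∀ q, q ≠ o (a s) → q ≠ o (-a s) →
      inner ℝ ((sgd sel P a ηe ηr zs θ₀ T).router s') (P q) <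
        inner ℝ ((sgd sel P a ηe ηr zs θ₀ T).router s') (P (o (a s)))) ∧
    X ≤ 4 * ηr * (l * Real.exp (Λ + 1)) * T * Real.exp (2 * Λ + 2) *
      hidden (sgd sel P a ηe ηr zs θ₀ T) s' (P (o (a s))) := by
  have hd1 : (1 : ℝ) ≤ Real.sqrt d := by
    rw [Real.one_le_sqrt]
    exact_mod_cast (Nat.zero_le _).trans_lt (o 1).2
  have hΛ0 : 0 ≤ Λ := (norm_nonneg _).trans hΛ
  have hpos : 0 ≤ ηr * (m * (C + ηe * T)) := by
    have h1 := mul_nonneg hrun.expert_rate_nonneg (Nat.cast_nonneg (α := ℝ) T)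
    exact mul_nonneg hrun.router_rate_nonneg
      (mul_nonneg (Nat.cast_nonneg m) (by linarith [hrun.one_le]))
  rw [← hss] at hX ⊢
  set θ := sgd sel P a ηe ηr zs θ₀ T with hθ
  set w := inner ℝ (θ.router s') (P (o (a s'))) with hw
  set w₀ := inner ℝ (θ₀.router s') (P (o (a s'))) with hw₀
  have hε1 : ηr * (m * (C + ηe * T)) * ε ≤ 1 := by
    have := mul_nonneg hpos hε0
    nlinarith
  have hdown : w₀ - 1 / 2 ≤ w := by
    have := hrun.router_main_ge le_rfl
    simp only [sgd] at this
    linarith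
  -- The norm change is at most the distance moved. Apart from the motion along the pattern of its
  -- own class, the router moves by at most `1/2` along the opposite pattern and `1/2` along all
  -- irrelevant ones together.
  have hdist : ‖θ.router s' - θ₀.router s'‖ ≤
      |w - w₀| + 1 / 2 + Real.sqrt d * (ηr * (m * (C + ηe * T)) * ε) := by
    refine norm_le_of_coordinates hP _ (p := o (a s')) (p' := o (-a s'))
      (fun h => units_ne_neg_self _ (ho h)) ?_ ?_ (mul_nonneg hpos hε0) fun q hq hq' => ?_
    · rw [inner_sub_left]
    · rw [inner_sub_left]
      exact (hrun.router_opposite_abs le_rfl fun h => neg_units_ne_self _ (ho h)).trans hopp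
    · rw [inner_sub_left]
      exact hrun.router_irrelevant_abs le_rfl hq hq'
  have habs : |w - w₀| ≤ w - w₀ + 1 := abs_le.2 ⟨by linarith, by linarith⟩
  have hw₀Λ := abs_le.1 ((abs_inner_pattern_le hP (θ₀.router s') (o (a s'))).trans hΛ')
  -- The coordinate of `s` minus `Λ` is at most the norm change of `s`, hence of `s'`, which is at
  -- most `w - w₀ + 2`; finally `-w₀ ≤ Λ`.
  have hcomp : inner ℝ (θ.router s) (P (o (a s'))) ≤ w + (2 * Λ + 2) := by
    have h1 := (le_abs_self _).trans (abs_inner_pattern_le hP (θ.router s) (o (a s')))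
    have h2 := norm_sub_norm_le (θ.router s') (θ₀.router s')
    simp only [normChange] at hle
    linarith
  have hXw : X ≤ Real.exp w * Real.exp (2 * Λ + 2) := by
    rw [← Real.exp_add]
    exact hX.trans (Real.exp_le_exp.2 hcomp)
  have hexp3 : Real.exp (3 * Λ + 3) = Real.exp (Λ + 1) * Real.exp (2 * Λ + 2) := by
    rw [← Real.exp_add]; ring_nf
  have hw1 : 2 * Real.exp (Λ + 1) < Real.exp w := by
    rw [hexp3] at hXlarge
    by_contra hcon
    nlinarith [Real.exp_pos (2 * Λ + 2)]
  refine ⟨fun q hq hq' => ?_, ?_⟩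
  · have h1 := (router_ge_of_abs hP hrun hΛ' hε1 le_rfl hq hq').2
    have h2 : Λ + 1 < w := Real.exp_lt_exp.1 (by linarith [Real.exp_pos (Λ + 1)])
    exact h1.trans_lt h2
  · have h1 := hrun.exp_router_main_le (S := l * Real.exp (Λ + 1)) hstep fun t ht b =>
      exp_mul_gate_mul_one_sub_le hsel hl ho _ (hzs t b) fun q hq hq' =>
        (router_ge_of_abs hP hrun hΛ' hε1 ht.le hq hq').2
    have h2 : Real.exp w₀ ≤ Real.exp (Λ + 1) := Real.exp_le_exp.2 (by linarith [hw₀Λ.2])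
    change Real.exp w ≤ Real.exp w₀ + 2 * ηr * hidden θ s' (P (o (a s'))) *
      (l * Real.exp (Λ + 1)) * T at h1
    -- By `hw1` the initial value `exp w₀` is less than half of `exp w`, so the growth term accounts
    -- for the other half; this turns `2` into `4`.
    have h3 : Real.exp w ≤ 4 * ηr * (l * Real.exp (Λ + 1)) * T *
        hidden θ s' (P (o (a s'))) := by linarith
    have h4 := mul_le_mul_of_nonneg_right h3 (Real.exp_pos (2 * Λ + 2)).le
    linarith

end Compare

/-! ### Survivors of the pruning, and the sign of the output -/

theorem notMem_range_iff {d : ℕ} {o : ℤˣ → Fin d} {q : Fin d} (c : ℤˣ) :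
    q ∉ Set.range o ↔ q ≠ o c ∧ q ≠ o (-c) := by
  constructor
  · intro h
    exact ⟨fun h' => h ⟨c, h'.symm⟩, fun h' => h ⟨-c, h'.symm⟩⟩
  · rintro ⟨h1, h2⟩ ⟨c', rfl⟩
    by_cases h : c' = c
    · exact h1 (by rw [h])
    · exact h2 (by rw [Int.units_ne_iff_eq_neg.1 h])

/-- If the experts of a set `V` amount to a fraction at least `ρ` of their class, then some
retained expert of the class has changed at least as much as any given expert outside `V`. -/
theorem IsRetained.exists_ge {k : ℕ} {a : Fin k → ℤˣ} {Δ : Fin k → ℝ} {ρ : ℝ}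
    {R : Finset (Fin k)} (hR : IsRetained a Δ ρ R) {c : ℤˣ} {s : Fin k} (hs : a s = c)
    {V : Finset (Fin k)} (hV : V ⊆ headSet a c) (hsV : s ∉ V)
    (hcard : ρ * ((headSet a c).card : ℝ) ≤ V.card) : ∃ s' ∈ R, a s' = c ∧ Δ s ≤ Δ s' := by
  have hsS : s ∈ headSet a c := Finset.mem_filter.2 ⟨Finset.mem_univ _, hs⟩
  by_cases hsR : s ∈ R
  · exact ⟨s, hsR, hs, le_rfl⟩
  obtain ⟨h1, -, h3⟩ := hR c
  have hlt : V.card < (headSet a c).card :=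
    Finset.card_lt_card ⟨hV, fun h => hsV (h hsS)⟩
  -- Since `s` lies outside `V`, the class has at least `|V| + 1` members, of which pruning claims a
  -- share of at most `|V|`. So even rounding down leaves one survivor.
  have hpos : 1 ≤ ⌊(1 - ρ) * ((headSet a c).card : ℝ)⌋₊ := by
    refine Nat.le_floor ?_
    have : (V.card : ℝ) + 1 ≤ (headSet a c).card := by exact_mod_cast hlt
    push_cast
    linarith
  obtain ⟨s', hs'⟩ := Finset.card_pos.1 (hpos.trans h1)
  have hmem := Finset.mem_inter.1 hs'
  exact ⟨s', hmem.2, (Finset.mem_filter.1 hmem.1).2,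
    h3 s' hs' s (Finset.mem_sdiff.2 ⟨hsS, hsR⟩)⟩

section Output
variable {n d m k l : ℕ} {sel : (Fin n → ℝ) → Finset (Fin n)} {P : Fin d → Vec d}
  {o : ℤˣ → Fin d} {a : Fin k → ℤˣ}

theorem hidden_nonneg (θ : Weights d m k) (s : Fin k) (v : Vec d) : 0 ≤ hidden θ s v :=
  Finset.sum_nonneg fun _ _ => le_max_right _ _

/-- The model classifies a sample correctly if one of its experts of the right class responds
strongly to the task-specific pattern, and no expert responds strongly to the patterns that it
should ignore. -/
theorem output_pos (hsel : IsTopSelector n l sel) (hl : 0 < l) (ho : Function.Injective o)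
    (θ : Weights d m k) {R : Finset (Fin k)} {z : Sample n d} (hz : IsValid o z) {s' : Fin k}
    (hs' : s' ∈ R) (has' : a s' = z.2) {M : ℝ} (hM0 : 0 ≤ M)
    (hM : ∀ s p, p ≠ o (a s) → hidden θ s (P p) ≤ M)
    (hgate : 1 / (l : ℝ) ≤ patternGate sel P θ s' z (o z.2))
    (hbig : l * (k * M) < hidden θ s' (P (o z.2))) :
    0 < sgn z.2 * output sel a θ R (tokens P z) := by
  set X : Fin k → ℝ := fun s => ∑ p, patternGate sel P θ s z p * hidden θ s (P p) with hX
  have hout : sgn z.2 * output sel a θ R (tokens P z) =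
      ∑ s ∈ R, sgn z.2 * sgn (a s) * X s := by
    rw [output, Finset.sum_comm, Finset.mul_sum]
    refine Finset.sum_congr rfl fun s _ => ?_
    rw [hX]
    simp only
    rw [sum_patternGate_mul θ s z fun p => hidden θ s (P p), Finset.mul_sum, Finset.mul_sum]
    refine Finset.sum_congr rfl fun j _ => ?_
    rw [tokens]
    ring
  have hX0 : ∀ s, 0 ≤ X s := fun s => Finset.sum_nonneg fun p _ =>
    mul_nonneg (patternGate_nonneg _ _ _ _) (hidden_nonneg _ _ _)
  have hterm : ∀ s, -M ≤ sgn z.2 * sgn (a s) * X s := by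
    intro s
    by_cases hs : z.2 = a s
    · rw [hs, sgn_mul_self, one_mul]
      linarith [hX0 s]
    · rw [sgn_mul_of_ne hs, neg_one_mul, neg_le_neg_iff]
      calc X s ≤ ∑ p, patternGate sel P θ s z p * M := by
            refine Finset.sum_le_sum fun p _ => ?_
            by_cases hp : p = o (a s)
            · rw [hp, patternGate_main_of_ne ho θ hz hs, zero_mul, zero_mul]
            · exact mul_le_mul_of_nonneg_left (hM s p hp) (patternGate_nonneg _ _ _ _)
        _ = M := by rw [← Finset.sum_mul, sum_patternGate hsel hl, one_mul]
  have hmain : k * M < sgn z.2 * sgn (a s') * X s' := by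
    have hl' : (0 : ℝ) < l := by exact_mod_cast hl
    rw [has', sgn_mul_self, one_mul]
    calc k * M < 1 / l * hidden θ s' (P (o z.2)) := by
          rw [one_div, ← div_eq_inv_mul, lt_div_iff₀ hl']
          linarith
      _ ≤ patternGate sel P θ s' z (o z.2) * hidden θ s' (P (o z.2)) :=
          mul_le_mul_of_nonneg_right hgate (hidden_nonneg _ _ _)
      _ ≤ X s' := Finset.single_le_sum
          (f := fun p => patternGate sel P θ s' z p * hidden θ s' (P p))
          (fun p _ => mul_nonneg (patternGate_nonneg _ _ _ _) (hidden_nonneg _ _ _))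
          (Finset.mem_univ _)
  rw [hout, ← Finset.add_sum_erase _ _ hs']
  have hrest : -(k * M) ≤ ∑ s ∈ R.erase s', sgn z.2 * sgn (a s) * X s := by
    calc -(k * M) ≤ -((R.erase s').card * M) := by
          have : ((R.erase s').card : ℝ) ≤ k := by
            exact_mod_cast (Finset.card_le_univ _).trans (by simp)
          have := mul_le_mul_of_nonneg_right this hM0
          linarith
      _ = ∑ _s ∈ R.erase s', -M := by simp
      _ ≤ _ := Finset.sum_le_sum fun s _ => hterm s
  linarith

end Output

/-! ### The deterministic theorem: good batches and admissible sizes -/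

/-- What is required of the training batches: every sample is valid, the irrelevant patterns are
rare, and over three time windows the important experts choose their task-specific pattern often
enough. -/
structure AreGoodBatches {n d m k B : ℕ} (sel : (Fin n → ℝ) → Finset (Fin n)) (P : Fin d → Vec d)
    (o : ℤˣ → Fin d) (a : Fin k → ℤˣ) (θ₀ : Weights d m k) (I : Set (Fin k)) (ε κ : ℝ)
    (S₀ S₁ T : ℕ) (zs : ℕ → Fin B → Sample n d) : Prop where
  valid : ∀ t b, IsValid o (zs t b)
  rare : ∀ q, q ∉ Set.range o →
    ∑ t ∈ Finset.range T, avg (fun b => (containing n q).indicator 1 (zs t b)) ≤ ε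
  frequent_early : ∀ s ∈ I, κ * S₀ ≤ ∑ t ∈ Finset.range S₀,
    avg fun b => (choosing sel P o θ₀ (a s) s).indicator 1 (zs t b)
  frequent_first : ∀ s ∈ I, κ * S₁ ≤ ∑ t ∈ Finset.range S₁,
    avg fun b => (choosing sel P o θ₀ (a s) s).indicator 1 (zs t b)
  frequent_second : ∀ s ∈ I, κ * (T - S₁) ≤ ∑ t ∈ Finset.Ico S₁ T,
    avg fun b => (choosing sel P o θ₀ (a s) s).indicator 1 (zs t b)

/-- The size conditions under which good batches lead to a good pruned model. -/
structure IsAdmissible (d m k l L : ℕ) (ηe ηr C ε Λ δ g κ ν Y : ℝ) (S₀ S₁ T : ℕ) : Prop where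
  expert_rate_nonneg : 0 ≤ ηe
  router_rate_nonneg : 0 ≤ ηr
  two_le : 2 ≤ l
  le : l ≤ L
  one_le : 1 ≤ C
  eps_nonneg : 0 ≤ ε
  gap_pos : 0 < δ
  gap_le : δ ≤ 1
  frac_nonneg : 0 ≤ ν
  gate_nonneg : 0 ≤ g
  gate_le : g ≤ 1 / (L * Real.exp (2 * Λ + 1))
  reserve_nonneg : 0 ≤ Y
  early_le : S₀ ≤ T
  first_le : S₁ ≤ T
  neuron_drift : ηe * ε ≤ 1
  router_gain : ηr * (m * C) * ε ≤ δ / 2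
  router_loss : ηr * (m * C) * S₀ ≤ δ / 2
  router_drift : Real.sqrt d * (ηr * (m * (C + ηe * T)) * ε) ≤ 1 / 2
  router_opposite : ηr * (m * C) * T ≤ 1 / 2
  router_speed : ηr * (m * (C + ηe * T)) ≤ 1
  growth_early : C ≤ ν * (ηe * g * (κ * S₀))
  growth_first : m * C + Y ≤ ν * m * (ηe * g * (κ * S₁))
  growth_router :
    2 * Real.exp (3 * Λ + 3) < ηr * Y * (Real.exp (-(Λ + 1)) * g ^ 2) * (κ * (T - S₁))
  growth_dominates :
    4 * ηr * (L * Real.exp (Λ + 1)) * T * Real.exp (2 * Λ + 2) * (L * (k * (m * C))) <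
      ηr * Y * (Real.exp (-(Λ + 1)) * g ^ 2) * (κ * (T - S₁))

section Main
variable {n d m k l L B : ℕ} {sel : (Fin n → ℝ) → Finset (Fin n)} {P : Fin d → Vec d}
  {o : ℤˣ → Fin d} {a : Fin k → ℤˣ} {ηe ηr : ℝ} {zs : ℕ → Fin B → Sample n d}
  {θ₀ : Weights d m k} {C ε Λ δ g κ ν Y : ℝ} {S₀ S₁ T : ℕ} {I : Set (Fin k)}

theorem AreGoodBatches.isControlledSGD
    (hgood : AreGoodBatches sel P o a θ₀ I ε κ S₀ S₁ T zs)
    (hadm : IsAdmissible d m k l L ηe ηr C ε Λ δ g κ ν Y S₀ S₁ T)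
    (hsel : IsTopSelector n l sel) (hP : Orthonormal ℝ P) (ho : Function.Injective o) (hB : 0 < B)
    (hneuron : ∀ s r, ‖θ₀.neuron s r‖ ≤ C - 1) (s : Fin k) :
    IsControlledSGD sel P o a ηe ηr zs θ₀ C ε T s where
  toIsExpertRun := sgd_isExpertRun hsel (by linarith [hadm.two_le]) hP ho hgood.valid hB
    hadm.expert_rate_nonneg hadm.router_rate_nonneg s
  one_le := hadm.one_le
  neuron_init r p := (le_abs_self _).trans ((abs_inner_pattern_le hP _ _).trans (hneuron s r))
  occ_le q hq hq' := hgood.rare q ((notMem_range_iff (a s)).2 ⟨hq, hq'⟩)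
  rate_occ_le := hadm.neuron_drift

/-- Training on good batches and pruning the experts with the smallest change of the router norm
yields a model that classifies every valid sample correctly. -/
theorem AreGoodBatches.output_pruned_pos
    (hgood : AreGoodBatches sel P o a θ₀ I ε κ S₀ S₁ T zs)
    (hadm : IsAdmissible d m k l L ηe ηr C ε Λ δ g κ ν Y S₀ S₁ T)
    (hsel : IsTopSelector n l sel) (hP : Orthonormal ℝ P) (ho : Function.Injective o) (hB : 0 < B)
    (hrouter : ∀ s, ‖θ₀.router s‖ ≤ Λ)
    (hneuron : ∀ s r, ‖θ₀.neuron s r‖ ≤ C - 1)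
    (himp : ∀ c : ℤˣ, ∃ s ∈ I, a s = c)
    (hsep : ∀ s ∈ I, ∀ q, q ∉ Set.range o →
      2 * δ ≤ |inner ℝ (θ₀.router s) (P (o (a s)) - P q)|)
    (hact : ∀ s ∈ I, ν * m ≤ ((Finset.univ.filter fun r =>
      0 ≤ inner ℝ (θ₀.neuron s r) (P (o (a s)))).card : ℝ))
    {ρ : ℝ} (V : ℤˣ → Finset (Fin k)) (hV : ∀ c, V c ⊆ headSet a c)
    (hVI : ∀ c, ∀ s ∈ V c, s ∉ I)
    (hcard : ∀ c, ρ * ((headSet a c).card : ℝ) ≤ (V c).card)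
    {R : Finset (Fin k)}
    (hR : IsRetained a (normChange θ₀ (sgd sel P a ηe ηr zs θ₀ T)) ρ R)
    {z : Sample n d} (hz : IsValid o z) :
    0 < sgn z.2 * output sel a (sgd sel P a ηe ηr zs θ₀ T) R (tokens P z) := by
  have hl : 0 < l := by linarith [hadm.two_le]
  have hlL : (l : ℝ) ≤ L := by exact_mod_cast hadm.le
  have hl0 : (0 : ℝ) < l := by exact_mod_cast hl
  have hηr := hadm.router_rate_nonneg
  have hrun := hgood.isControlledSGD hadm hsel hP ho hB hneuron
  obtain ⟨s, hsI, has⟩ := himp z.2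
  -- The important expert `s` may itself be pruned; it serves only as a yardstick for the survivor
  -- `s'`.
  obtain ⟨s', hs'R, has', hle⟩ := hR.exists_ge has (hV z.2) (fun h => hVI _ _ h hsI) (hcard z.2)
  have hd1 : (1 : ℝ) ≤ Real.sqrt d := by
    rw [Real.one_le_sqrt]
    exact_mod_cast (Nat.zero_le _).trans_lt (o 1).2
  have hpos : 0 ≤ ηr * (m * (C + ηe * T)) := by
    have h1 := mul_nonneg hadm.expert_rate_nonneg (Nat.cast_nonneg (α := ℝ) T)
    exact mul_nonneg hηr (mul_nonneg (Nat.cast_nonneg m) (by linarith [hadm.one_le]))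
  have hdrift : ηr * (m * (C + ηe * T)) * ε ≤ 1 := by
    have := mul_nonneg hpos hadm.eps_nonneg
    have := hadm.router_drift
    nlinarith
  have hexp := exp_router_ge_of_important hsel hadm.two_le hP ho hgood.valid (hrun s) (hrouter s)
    hadm.gap_pos hadm.gap_le hadm.frac_nonneg hadm.reserve_nonneg
    (fun q hq hq' => hsep s hsI q ((notMem_range_iff (a s)).2 ⟨hq, hq'⟩)) (hact s hsI)
    hadm.gate_nonneg (hadm.gate_le.trans (by gcongr)) hadm.early_le hadm.first_le
    (hgood.frequent_early s hsI) (hgood.frequent_first s hsI) (hgood.frequent_second s hsI)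
    hdrift hadm.router_gain hadm.router_loss hadm.growth_early hadm.growth_first
  obtain ⟨htop, hlarge⟩ := learned_of_normChange_ge hsel hl hP ho hgood.valid (has'.trans has.symm)
    (hrun s') (hrouter s) (hrouter s') hle hexp hadm.eps_nonneg hadm.growth_router
    hadm.router_drift hadm.router_opposite hadm.router_speed
  rw [has] at htop hlarge
  refine output_pos hsel hl ho _ hz hs'R has' (hrun s).mC_nonneg
    (fun s p hp => (hrun s).activation_other_le le_rfl hp)
    (patternGate_ge_of_top hsel hl hz rfl htop) ?_
  have hmC := (hrun s).mC_nonneg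
  have hH := hidden_nonneg (sgd sel P a ηe ηr zs θ₀ T) s' (P (o z.2))
  have hdom := hadm.growth_dominates.trans_le hlarge
  have h1 : 4 * ηr * (l * Real.exp (Λ + 1)) * T * Real.exp (2 * Λ + 2) *
      hidden (sgd sel P a ηe ηr zs θ₀ T) s' (P (o z.2)) ≤
      4 * ηr * (L * Real.exp (Λ + 1)) * T * Real.exp (2 * Λ + 2) *
      hidden (sgd sel P a ηe ηr zs θ₀ T) s' (P (o z.2)) := by gcongr
  refine lt_of_le_of_lt (b := (L : ℝ) * (k * (m * C))) (by gcongr) ?_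
  exact lt_of_mul_lt_mul_left (hdom.trans_le h1) (by positivity)

end Main

/-! ### Verification of the size conditions -/

set_option maxHeartbeats 1000000 in
/-- In the regime of the learning rates and of the training time considered, the size conditions
hold once `d` is large. Here `x = ηe * T`, `y = √d`. -/
theorem isAdmissible_of_large {d m k l L T : ℕ} {C A κ g ν cp E K x y ηmax ηmin τ₁ τ₂ β₁ ηe ηr : ℝ}
    (hC : 1 ≤ C) (hA : 1 ≤ A) (hκ : 0 < κ) (hν : 0 < ν) (hcp : 0 < cp)
    (hl : 2 ≤ l) (hlL : l ≤ L) (hm : 0 < m) (hηe : 0 < ηe) (hηeE : ηe ≤ E)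
    (hηmax : 0 < ηmax) (hηmin : 0 < ηmin) (hτ₂ : 0 ≤ τ₂)
    {Λ : ℝ} (hg : g = 1 / (L * Real.exp (2 * Λ + 1)))
    (hβ₁ : β₁ = ν * g * κ / 6)
    (hηmax_le : ηmax * (4 * C * (C / (ν * g * κ) + E)) ≤ cp)
    (hx : x = ηe * T) (hy : y = Real.sqrt d) (hy1 : 1 ≤ y)
    (hx1 : τ₁ * y ≤ x) (hx2 : x ≤ τ₂ * y)
    (hr1 : ηr * m ≤ ηmax * ηe / d) (hr2 : ηmin * ηe / (d * L ^ 2) ≤ ηr * m)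
    (hk : (k : ℝ) ≤ K * y)
    (hτone : 1 ≤ τ₁) (hτC : C ≤ β₁ * τ₁)
    (hτrouter : 4 * L ^ 2 * Real.exp (3 * Λ + 3) <
      ηmin * β₁ * (Real.exp (-(Λ + 1)) * g ^ 2 * κ) * τ₁)
    (hτdom : 8 * L ^ 2 * Real.exp (3 * Λ + 3) * C * K <
      β₁ * (Real.exp (-(Λ + 1)) * g ^ 2 * κ) * τ₁)
    (hD1 : 2 * A * τ₂ ≤ y) (hD2 : 8 * ηmax * C * A * τ₂ ≤ cp * y)
    (hD3 : 4 * ηmax * A * (C + τ₂) * τ₂ ≤ y) (hD4 : 2 * ηmax * C * τ₂ ≤ y)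
    (hD5 : ηmax * E * (C + τ₂) ≤ y) (hD6 : cp ≤ y) (hD7 : C / (ν * g * κ) + E ≤ y)
    (hD8 : 2 * E ≤ y) :
    IsAdmissible d m k l L ηe ηr C (2 * A * T / d) Λ (cp / (2 * d)) g κ ν (m * β₁ * x)
      ⌈C / (ν * g * κ) / ηe⌉₊ (T / 2) T := by
  have hy0 : 0 < y := by linarith
  have hd : (d : ℝ) = y ^ 2 := by rw [hy, Real.sq_sqrt (by positivity)]
  have hL0 : (0 : ℝ) < L := by exact_mod_cast (by omega : 0 < L)
  have hm0 : (0 : ℝ) < m := by exact_mod_cast hm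
  have hC0 : 0 < C := by linarith
  have hA0 : 0 < A := by linarith
  have hE0 : 0 < E := by linarith
  have hg0 : 0 < g := by rw [hg]; positivity
  have hβ₁0 : 0 < β₁ := by rw [hβ₁]; positivity
  have hr0 : 0 < ηr * m := lt_of_lt_of_le (by rw [hd]; positivity) hr2
  have hηr : 0 < ηr := pos_of_mul_pos_left hr0 hm0.le
  have hyx : y ≤ x := (le_mul_of_one_le_left hy0.le hτone).trans hx1
  have hx0 : 0 < x := by linarith
  set C₇ := C / (ν * g * κ) with hC₇
  have hC₇0 : 0 < C₇ := by positivity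
  set r := ηr * m with hr
  rw [hd] at hr1 hr2
  have hr1' : r * y ^ 2 ≤ ηmax * ηe := (le_div_iff₀ (by positivity)).1 hr1
  have hr2' : ηmin * ηe ≤ r * (y ^ 2 * L ^ 2) := (div_le_iff₀ (by positivity)).1 hr2
  have hT2 : 2 ≤ T := by
    have h1 : (2 : ℝ) * E ≤ E * T := by
      calc 2 * E ≤ x := by linarith
        _ ≤ E * T := by rw [hx]; gcongr
    exact_mod_cast le_of_mul_le_mul_left (by linarith : E * 2 ≤ E * (T : ℝ)) hE0
  have hT0 : (0 : ℝ) < T := by exact_mod_cast (by omega : 0 < T)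
  have hS₁lo : (T : ℝ) / 3 ≤ ((T / 2 : ℕ) : ℝ) := by
    have : T ≤ 3 * (T / 2) := by omega
    have : (T : ℝ) ≤ 3 * ((T / 2 : ℕ) : ℝ) := by exact_mod_cast this
    linarith
  have hS₁hi : (T : ℝ) / 2 ≤ T - ((T / 2 : ℕ) : ℝ) := by
    have : 2 * (T / 2) ≤ T := by omega
    have : 2 * ((T / 2 : ℕ) : ℝ) ≤ T := by exact_mod_cast this
    linarith
  have hS₀lo : C₇ / ηe ≤ (⌈C₇ / ηe⌉₊ : ℝ) := Nat.le_ceil _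
  -- Rounding the early time up costs at most one step, that is `ηe ≤ E`; this is the origin of `E`
  -- in the condition on `ηmax`.
  have hS₀hi : ηe * (⌈C₇ / ηe⌉₊ : ℝ) ≤ C₇ + E := by
    have := (Nat.ceil_lt_add_one (a := C₇ / ηe) (by positivity)).le
    calc ηe * (⌈C₇ / ηe⌉₊ : ℝ) ≤ ηe * (C₇ / ηe + 1) := by gcongr
      _ = C₇ + ηe := by field_simp
      _ ≤ C₇ + E := by linarith
  -- `r * T` and `r * (C + x)` are small
  have hrT : r * T * y ≤ ηmax * τ₂ := by
    have h1 : r * y ^ 2 * T ≤ ηmax * ηe * T := by gcongr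
    have h2 : ηmax * x ≤ ηmax * (τ₂ * y) := by gcongr
    have h3 : r * T * y * y ≤ ηmax * τ₂ * y := by
      calc r * T * y * y = r * y ^ 2 * T := by ring
        _ ≤ ηmax * x := by rw [hx]; linarith
        _ ≤ _ := by linarith
    exact le_of_mul_le_mul_right h3 hy0
  have hCx : C + x ≤ (C + τ₂) * y := by
    have := mul_le_mul_of_nonneg_left hy1 hC0.le
    linarith
  have hεy : (2 * A * T / d : ℝ) = 2 * A * T / y ^ 2 := by rw [hd]
  set X := ηr * (m * β₁ * x) * (Real.exp (-(Λ + 1)) * g ^ 2) * (κ * (T - (T / 2 : ℕ))) with hX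
  set c₂ := Real.exp (-(Λ + 1)) * g ^ 2 * κ with hc₂
  have hc₂0 : 0 < c₂ := by positivity
  have hXlo : r * β₁ * x * c₂ * (T / 2) ≤ X := by
    calc r * β₁ * x * c₂ * (T / 2) ≤ r * β₁ * x * c₂ * (T - (T / 2 : ℕ)) := by gcongr
      _ = X := by rw [hX, hc₂, hr]; ring
  refine
    { expert_rate_nonneg := hηe.le
      router_rate_nonneg := hηr.le
      two_le := hl
      le := hlL
      one_le := hC
      eps_nonneg := by positivity
      gap_pos := by rw [hd]; positivity
      gap_le := ?_
      frac_nonneg := hν.le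
      gate_nonneg := hg0.le
      gate_le := hg.le
      reserve_nonneg := by positivity
      early_le := ?_
      first_le := Nat.div_le_self _ _
      neuron_drift := ?_
      router_gain := ?_
      router_loss := ?_
      router_drift := ?_
      router_opposite := ?_
      router_speed := ?_
      growth_early := ?_
      growth_first := ?_
      growth_router := ?_
      growth_dominates := ?_ }
  · rw [hd, div_le_one (by positivity)]
    have : y * 1 ≤ y * y := by gcongr
    linarith [sq y, sq_nonneg y]
  · have h1 : ηe * (⌈C₇ / ηe⌉₊ : ℝ) ≤ ηe * T := by linarith
    exact_mod_cast le_of_mul_le_mul_left h1 hηe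
  · rw [hεy, ← mul_div_assoc, div_le_one (by positivity)]
    calc ηe * (2 * A * T) = 2 * A * x := by rw [hx]; ring
      _ ≤ 2 * A * (τ₂ * y) := by gcongr
      _ = 2 * A * τ₂ * y := by ring
      _ ≤ y * y := by gcongr
      _ = y ^ 2 := by ring
  · rw [hεy, hd]
    have h1 : r * T * (4 * C * A * 2) ≤ cp := by
      have : r * T * (4 * C * A * 2) * y ≤ cp * y := by
        calc r * T * (4 * C * A * 2) * y = r * T * y * (8 * C * A) := by ring
          _ ≤ ηmax * τ₂ * (8 * C * A) := by gcongr
          _ ≤ cp * y := by linarith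
      exact le_of_mul_le_mul_right this hy0
    have h2 : ηr * (m * C) * (2 * A * T / y ^ 2) = r * T * (4 * C * A * 2) / (4 * y ^ 2) := by
      rw [hr]; field_simp
    have h3 : cp / (2 * y ^ 2) / 2 = cp / (4 * y ^ 2) := by field_simp; ring
    rw [h2, h3]
    gcongr
  · rw [hd]
    -- The early loss and the separation are both of order `1/d`, so a large `d` does not help: this
    -- is where `ηmax` has to be small.
    have h1 : r * C * (⌈C₇ / ηe⌉₊ : ℝ) * y ^ 2 ≤ cp / 4 := by
      calc r * C * (⌈C₇ / ηe⌉₊ : ℝ) * y ^ 2 = r * y ^ 2 * (C * (⌈C₇ / ηe⌉₊ : ℝ)) := by ring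
        _ ≤ ηmax * ηe * (C * (⌈C₇ / ηe⌉₊ : ℝ)) := by gcongr
        _ = ηmax * C * (ηe * (⌈C₇ / ηe⌉₊ : ℝ)) := by ring
        _ ≤ ηmax * C * (C₇ + E) := by gcongr
        _ ≤ cp / 4 := by linarith
    have h2 : ηr * (m * C) * (⌈C₇ / ηe⌉₊ : ℝ) = r * C * (⌈C₇ / ηe⌉₊ : ℝ) := by rw [hr]; ring
    rw [h2, show cp / (2 * y ^ 2) / 2 = cp / 4 / y ^ 2 by field_simp; ring,
      le_div_iff₀ (by positivity)]
    exact h1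
  · rw [← hy, hεy, ← hx]
    have h1 : y * (ηr * (m * (C + x)) * (2 * A * T / y ^ 2)) =
        r * T * y * (C + x) * (2 * A) / y ^ 2 := by
      rw [hr]; field_simp
    rw [h1, div_le_iff₀ (by positivity)]
    calc r * T * y * (C + x) * (2 * A) ≤ ηmax * τ₂ * ((C + τ₂) * y) * (2 * A) := by gcongr
      _ = 4 * ηmax * A * (C + τ₂) * τ₂ * y / 2 := by ring
      _ ≤ y * y / 2 := by gcongr
      _ = 1 / 2 * y ^ 2 := by ring
  · have h1 : r * T * C * y ≤ 1 / 2 * y := by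
      calc r * T * C * y = r * T * y * C := by ring
        _ ≤ ηmax * τ₂ * C := by gcongr
        _ ≤ 1 / 2 * y := by linarith
    have := le_of_mul_le_mul_right h1 hy0
    calc ηr * (m * C) * T = r * T * C := by rw [hr]; ring
      _ ≤ 1 / 2 := this
  · rw [← hx]
    have h1 : r * (C + x) * y ^ 2 ≤ 1 * y ^ 2 := by
      calc r * (C + x) * y ^ 2 = r * y ^ 2 * (C + x) := by ring
        _ ≤ ηmax * ηe * ((C + τ₂) * y) := by gcongr
        _ ≤ ηmax * E * ((C + τ₂) * y) := by gcongr
        _ = ηmax * E * (C + τ₂) * y := by ring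
        _ ≤ y * y := by gcongr
        _ = 1 * y ^ 2 := by ring
    have := le_of_mul_le_mul_right h1 (by positivity)
    calc ηr * (m * (C + x)) = r * (C + x) := by rw [hr]; ring
      _ ≤ 1 := this
  · calc C = ν * (ηe * g * (κ * (C₇ / ηe))) := by rw [hC₇]; field_simp
      _ ≤ _ := by gcongr
  · have h1 : C ≤ β₁ * x := by
      calc C ≤ β₁ * τ₁ := hτC
        _ ≤ β₁ * x := by
          gcongr
          exact (le_mul_of_one_le_right (by linarith) hy1).trans hx1
    calc m * C + m * β₁ * x ≤ m * (β₁ * x) + m * β₁ * x := by gcongr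
      _ = ν * m * (ηe * g * (κ * (T / 3))) := by rw [hβ₁, hx]; ring
      _ ≤ _ := by gcongr
  · refine lt_of_lt_of_le ?_ hXlo
    -- The growth of `exp w` is of order `x² / d`, independent of `d`, so reaching the threshold
    -- requires the lower bound `ηmin` and a large `τ₁`.
    have h1 : ηmin * x ^ 2 ≤ r * x * T * (y ^ 2 * L ^ 2) := by
      calc ηmin * x ^ 2 = ηmin * ηe * (x * T) := by rw [hx]; ring
        _ ≤ r * (y ^ 2 * L ^ 2) * (x * T) := by gcongr
        _ = _ := by ring
    have h2 : τ₁ * y ^ 2 ≤ x ^ 2 := by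
      calc τ₁ * y ^ 2 = τ₁ * y * y := by ring
        _ ≤ x * x := by gcongr
        _ = x ^ 2 := by ring
    have h3 : ηmin * τ₁ ≤ r * x * T * L ^ 2 := by
      have : ηmin * τ₁ * y ^ 2 ≤ r * x * T * L ^ 2 * y ^ 2 := by
        have := mul_le_mul_of_nonneg_left h2 hηmin.le
        linarith
      exact le_of_mul_le_mul_right this (by positivity)
    have h4 : ηmin * β₁ * c₂ * τ₁ ≤ r * β₁ * x * c₂ * (T / 2) * 2 * L ^ 2 := by
      calc ηmin * β₁ * c₂ * τ₁ = ηmin * τ₁ * (β₁ * c₂) := by ring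
        _ ≤ r * x * T * L ^ 2 * (β₁ * c₂) := by gcongr
        _ = _ := by ring
    have h5 : 2 * Real.exp (3 * Λ + 3) * (2 * L ^ 2) <
        r * β₁ * x * c₂ * (T / 2) * (2 * L ^ 2) := by linarith
    exact lt_of_mul_lt_mul_right h5 (by positivity)
  · refine lt_of_lt_of_le ?_ hXlo
    have hexp : Real.exp (Λ + 1) * Real.exp (2 * Λ + 2) = Real.exp (3 * Λ + 3) := by
      rw [← Real.exp_add]; ring_nf
    -- The router rate cancels from both sides. What is left compares `k ≤ K * √d` with `x ≥ τ₁ *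
    -- √d`.
    have h1 : 8 * L ^ 2 * Real.exp (3 * Λ + 3) * C * k < β₁ * c₂ * x := by
      calc 8 * L ^ 2 * Real.exp (3 * Λ + 3) * C * k
          ≤ 8 * L ^ 2 * Real.exp (3 * Λ + 3) * C * (K * y) := by gcongr
        _ = 8 * L ^ 2 * Real.exp (3 * Λ + 3) * C * K * y := by ring
        _ < β₁ * c₂ * τ₁ * y := by gcongr
        _ = β₁ * c₂ * (τ₁ * y) := by ring
        _ ≤ β₁ * c₂ * x := by gcongr
    calc 4 * ηr * (L * Real.exp (Λ + 1)) * T * Real.exp (2 * Λ + 2) * (L * (k * (m * C)))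
        = r * (T / 2) * (8 * L ^ 2 * (Real.exp (Λ + 1) * Real.exp (2 * Λ + 2)) * C * k) := by
          rw [hr]; ring
      _ < r * (T / 2) * (β₁ * c₂ * x) := by
          rw [hexp]
          gcongr
      _ = _ := by ring


/-! ### Probability of good batches -/

theorem card_mul_sum_avg {B : ℕ} (hB : 0 < B) (W : Finset ℕ) (f : ℕ → Fin B → ℝ) :
    B * ∑ t ∈ W, avg (f t) = ∑ i ∈ W ×ˢ Finset.univ, f i.1 i.2 := by
  have : (B : ℝ) ≠ 0 := by positivity
  rw [Finset.sum_product, Finset.mul_sum]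
  refine Finset.sum_congr rfl fun t _ => ?_
  rw [avg]
  field_simp

section Window
variable {Ω 𝓧 : Type*} [MeasurableSpace Ω] [MeasurableSpace 𝓧] (μ : Measure Ω)
  [IsProbabilityMeasure μ] {D : Measure 𝓧} {B : ℕ}
  {Z : ℕ → Fin B → Ω → 𝓧}

/-- Hoeffding's inequality for the batches of a time window, upper tail. -/
theorem window_upper (hB : 0 < B) (hZ : ∀ t b, HasLaw (Z t b) D μ)
    (hind : iIndepFun (fun i : ℕ × Fin B => Z i.1 i.2) μ) {S : Set 𝓧} (hS : MeasurableSet S)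
    (W : Finset ℕ) {δ : ℝ} (hδ : 0 ≤ δ) :
    μ {ω | W.card * (D.real S + δ) < ∑ t ∈ W, avg fun b => S.indicator 1 (Z t b ω)} ≤
      ENNReal.ofReal (Real.exp (-(2 * (W.card * B) * δ ^ 2))) := by
  have h := hoeffding_upper μ D (fun i : ℕ × Fin B => Z i.1 i.2) (fun i => hZ i.1 i.2) hind S hS
    (W ×ˢ Finset.univ) δ hδ
  rw [Finset.card_product, Finset.card_univ, Fintype.card_fin, Nat.cast_mul] at h
  refine (ENNReal.le_ofReal_iff_toReal_le (measure_ne_top _ _) (Real.exp_pos _).le).2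
    ((measureReal_mono ?_).trans h)
  intro ω hω
  have hB' : (0 : ℝ) < B := by exact_mod_cast hB
  have := mul_lt_mul_of_pos_left (Set.mem_ofPred_eq ▸ hω) hB'
  rw [card_mul_sum_avg hB] at this
  rw [Set.mem_ofPred_eq]
  linarith

/-- Hoeffding's inequality for the batches of a time window, lower tail. -/
theorem window_lower [IsProbabilityMeasure D] (hB : 0 < B) (hZ : ∀ t b, HasLaw (Z t b) D μ)
    (hind : iIndepFun (fun i : ℕ × Fin B => Z i.1 i.2) μ) {S : Set 𝓧} (hS : MeasurableSet S)
    (W : Finset ℕ) {δ : ℝ} (hδ : 0 ≤ δ) :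
    μ {ω | ∑ t ∈ W, avg (fun b => S.indicator 1 (Z t b ω)) < W.card * (D.real S - δ)} ≤
      ENNReal.ofReal (Real.exp (-(2 * (W.card * B) * δ ^ 2))) := by
  have h := hoeffding_lower μ D (fun i : ℕ × Fin B => Z i.1 i.2) (fun i => hZ i.1 i.2) hind S hS
    (W ×ˢ Finset.univ) δ hδ
  rw [Finset.card_product, Finset.card_univ, Fintype.card_fin, Nat.cast_mul] at h
  refine (ENNReal.le_ofReal_iff_toReal_le (measure_ne_top _ _) (Real.exp_pos _).le).2
    ((measureReal_mono ?_).trans h)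
  intro ω hω
  have hB' : (0 : ℝ) < B := by exact_mod_cast hB
  have := mul_lt_mul_of_pos_left (Set.mem_ofPred_eq ▸ hω) hB'
  rw [card_mul_sum_avg hB] at this
  rw [Set.mem_ofPred_eq]
  linarith

end Window

section Good
variable {n d m k l B : ℕ} {sel : (Fin n → ℝ) → Finset (Fin n)} {P : Fin d → Vec d}
  {o : ℤˣ → Fin d} {a : Fin k → ℤˣ} {θ₀ : Weights d m k} {A π₀ : ℝ}
  {D : Measure (Sample n d)}

/-- Dropping the condition on the gating value only enlarges the event, and undoing the conditioning
costs the probability of the class. -/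
theorem IsDataModel.choosing_ge (hD : IsDataModel o A π₀ D) {p₀ : ℝ} (hp₀ : 0 < p₀)
    {c : ℤˣ} {s : Fin k} (hs : p₀ ≤ proficiency sel P o l D θ₀ c s) :
    π₀ * p₀ ≤ D.real (choosing sel P o θ₀ c s) := by
  have := hD.isProb
  set S : Set (Sample n d) := {z | z.2 = c} with hS
  have hS0 := hD.class_prob c
  rw [← hS] at hS0
  unfold proficiency at hs
  rw [← hS, measureReal_def, cond_apply .of_discrete, ENNReal.toReal_mul,
    ENNReal.toReal_inv, ← measureReal_def, ← measureReal_def] at hs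
  set Q := D.real (choosing sel P o θ₀ c s) with hQ
  have hle : D.real (S ∩ {z | ∃ j ∈ chosen sel θ₀ s (tokens P z), z.1 j = o c ∧
      1 / (l : ℝ) ≤ gate sel θ₀ s (tokens P z) j}) ≤ Q :=
    measureReal_mono fun z hz => ⟨hz.1, hz.2.choose, hz.2.choose_spec.1, hz.2.choose_spec.2.1⟩
  have hS1 : 0 ≤ D.real S := measureReal_nonneg
  rcases hS1.eq_or_lt with h0 | h0
  · rw [← h0] at hs
    simp at hs
    linarith
  · have h1 : p₀ ≤ (D.real S)⁻¹ * Q := hs.trans (by gcongr)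
    rw [← div_eq_inv_mul, le_div_iff₀ h0] at h1
    calc π₀ * p₀ ≤ D.real S * p₀ := by gcongr
      _ ≤ Q := by linarith

/-- Good batches are very likely. -/
theorem measure_not_areGoodBatches_le (hD : IsDataModel o A π₀ D) (hπ₀ : 0 < π₀) {p₀ A' : ℝ}
    (hp₀ : 0 < p₀) (hA : A ≤ A') (hA' : 1 ≤ A') {Ω : Type*} [MeasurableSpace Ω] (μ : Measure Ω)
    [IsProbabilityMeasure μ] (hB : 0 < B) {Z : ℕ → Fin B → Ω → Sample n d}
    (hZ : ∀ t b, HasLaw (Z t b) D μ) (hind : iIndepFun (fun i : ℕ × Fin B => Z i.1 i.2) μ)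
    {S₀ S₁ T : ℕ} (hS₀ : 1 ≤ S₀) (hS₁ : 1 ≤ S₁) (hT : S₁ < T) {X : ℝ}
    (hX1 : X ≤ 2 * (T * B) * (A' / d) ^ 2) (hX2 : X ≤ 2 * B * (π₀ * p₀ / 2) ^ 2) :
    μ {ω | ¬ AreGoodBatches sel P o a θ₀ {s | p₀ ≤ proficiency sel P o l D θ₀ (a s) s}
      (2 * A' * T / d) (π₀ * p₀ / 2) S₀ S₁ T fun t b => Z t b ω} ≤
      ENNReal.ofReal ((d + 3 * k) * Real.exp (-X)) := by
  have := hD.isProb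
  set I : Set (Fin k) := {s | p₀ ≤ proficiency sel P o l D θ₀ (a s) s} with hI
  set κ := π₀ * p₀ / 2 with hκ
  have hκ0 : 0 < κ := by positivity
  set F : Fin 3 → Finset ℕ := ![Finset.range S₀, Finset.range S₁, Finset.Ico S₁ T] with hF
  set badOcc : Fin d → Set Ω := fun q => {ω | q ∉ Set.range o ∧
    2 * A' * T / d < ∑ t ∈ Finset.range T, avg fun b => (containing n q).indicator 1 (Z t b ω)}
  set badWin : Fin k × Fin 3 → Set Ω := fun i => {ω | i.1 ∈ I ∧
    ∑ t ∈ F i.2, avg (fun b => (choosing sel P o θ₀ (a i.1) i.1).indicator 1 (Z t b ω)) <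
      κ * (F i.2).card}
  have hvalid : ∀ᵐ ω ∂μ, ∀ t b, IsValid o (Z t b ω) := by
    rw [ae_all_iff]
    intro t
    rw [ae_all_iff]
    intro b
    exact ((hZ t b).ae_iff (p := fun z => IsValid o z) .of_discrete).2 hD.task_specific
  have hnull : μ {ω | ¬ ∀ t b, IsValid o (Z t b ω)} = 0 := ae_iff.1 hvalid
  have hsub : {ω | ¬ AreGoodBatches sel P o a θ₀ I (2 * A' * T / d) κ S₀ S₁ T
      fun t b => Z t b ω} ⊆
      {ω | ¬ ∀ t b, IsValid o (Z t b ω)} ∪ ((⋃ q, badOcc q) ∪ ⋃ i, badWin i) := by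
    intro ω hω
    by_contra hcon
    simp only [Set.mem_union, Set.mem_iUnion, not_or, not_exists] at hcon
    obtain ⟨h1, h2, h3⟩ := hcon
    have hwin : ∀ s ∈ I, ∀ i : Fin 3, κ * (F i).card ≤
        ∑ t ∈ F i, avg fun b => (choosing sel P o θ₀ (a s) s).indicator 1 (Z t b ω) :=
      fun s hs i => not_lt.1 fun h => h3 (s, i) ⟨hs, h⟩
    refine hω ⟨not_not.1 h1, fun q hq => not_lt.1 fun h => h2 q ⟨hq, h⟩, fun s hs => ?_,
      fun s hs => ?_, fun s hs => ?_⟩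
    · simpa [hF] using hwin s hs 0
    · simpa [hF] using hwin s hs 1
    · have := hwin s hs 2
      simpa [hF, Nat.cast_sub hT.le] using this
  have hocc : ∀ q, μ (badOcc q) ≤ ENNReal.ofReal (Real.exp (-X)) := by
    intro q
    by_cases hq : q ∈ Set.range o
    · have : badOcc q = ∅ := Set.eq_empty_of_forall_notMem fun ω h => h.1 hq
      simp [this]
    have hd0 : (0 : ℝ) < d := by exact_mod_cast (Nat.zero_le _).trans_lt q.2
    refine (measure_mono ?_).trans ((window_upper μ hB hZ hind (S := containing n q) .of_discrete
      (Finset.range T) (δ := A' / d) (by positivity)).trans ?_)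
    · intro ω hω
      refine lt_of_le_of_lt ?_ hω.2
      have h1 : D.real (containing n q) ≤ A' / d := (hD.rare q hq).trans (by gcongr)
      rw [Finset.card_range]
      calc (T : ℝ) * (D.real (containing n q) + A' / d) ≤ T * (A' / d + A' / d) := by gcongr
        _ = 2 * A' * T / d := by ring
    · rw [Finset.card_range]
      gcongr
  have hwin : ∀ i, μ (badWin i) ≤ ENNReal.ofReal (Real.exp (-X)) := by
    rintro ⟨s, i⟩
    by_cases hs : s ∈ I
    swap
    · have : badWin (s, i) = ∅ := Set.eq_empty_of_forall_notMem fun ω h => hs h.1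
      simp [this]
    have hcard : 1 ≤ (F i).card := by
      fin_cases i
      · simpa [hF] using hS₀
      · simpa [hF] using hS₁
      · simp [hF]
        omega
    refine (measure_mono ?_).trans ((window_lower μ hB hZ hind
      (S := choosing sel P o θ₀ (a s) s) .of_discrete (F i) hκ0.le).trans ?_)
    · intro ω hω
      refine lt_of_lt_of_le hω.2 ?_
      have := hD.choosing_ge hp₀ hs
      -- As `κ` is half of the guaranteed probability `π₀ * p₀`, a deviation of `κ` is allowed.
      have h1 : κ ≤ D.real (choosing sel P o θ₀ (a s) s) - κ := by rw [hκ]; linarith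
      calc κ * (F i).card = (F i).card * κ := by ring
        _ ≤ _ := by gcongr
    -- A window may be as short as one step; a single batch already concentrates enough.
    · have h1 : (1 : ℝ) ≤ (F i).card := by exact_mod_cast hcard
      have h2 : 2 * B * κ ^ 2 ≤ 2 * ((F i).card * B) * κ ^ 2 := by
        gcongr
        exact le_mul_of_one_le_left (by positivity) h1
      gcongr
      linarith
  calc _ ≤ μ {ω | ¬ ∀ t b, IsValid o (Z t b ω)} + (μ (⋃ q, badOcc q) + μ (⋃ i, badWin i)) :=
        (measure_mono hsub).trans ((measure_union_le _ _).trans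
          (add_le_add_right (measure_union_le _ _) _))
    _ ≤ 0 + (∑ _q : Fin d, ENNReal.ofReal (Real.exp (-X)) +
        ∑ _i : Fin k × Fin 3, ENNReal.ofReal (Real.exp (-X))) := by
        rw [hnull]
        gcongr
        · exact (measure_iUnion_fintype_le _ _).trans (Finset.sum_le_sum fun q _ => hocc q)
        · exact (measure_iUnion_fintype_le _ _).trans (Finset.sum_le_sum fun i _ => hwin i)
    _ = ENNReal.ofReal ((d + 3 * k) * Real.exp (-X)) := by
        rw [zero_add, Finset.sum_const, Finset.sum_const, Finset.card_univ, Finset.card_univ,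
          Fintype.card_prod, Fintype.card_fin, Fintype.card_fin, Fintype.card_fin, ← add_smul,
          nsmul_eq_mul, ENNReal.ofReal_mul (by positivity)]
        congr 1
        rw [show ((d : ℝ) + 3 * k) = ((d + k * 3 : ℕ) : ℝ) by push_cast; ring,
          ENNReal.ofReal_natCast]

/-- Exponential decay in `√d` beats every power of `d`. -/
theorem exists_poly_mul_exp_le (M c : ℝ) (hc : 0 < c) (N : ℕ) :
    ∃ Y : ℝ, ∀ y, Y ≤ y → M * y ^ 2 * Real.exp (-(c * y)) ≤ 1 / (y ^ 2) ^ N := by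
  have h := (Real.tendsto_pow_mul_exp_neg_atTop_nhds_zero (2 * N + 2)).comp
    (Filter.tendsto_id.const_mul_atTop hc)
  have h2 := h.const_mul (M / c ^ (2 * N + 2))
  rw [mul_zero] at h2
  obtain ⟨Y, hY⟩ := Filter.eventually_atTop.1
    ((h2.eventually_le_const one_pos).and (Filter.eventually_gt_atTop 0))
  refine ⟨Y, fun y hy => ?_⟩
  obtain ⟨h3, h4⟩ := hY y hy
  rw [le_div_iff₀ (by positivity)]
  refine le_trans (le_of_eq ?_) h3
  simp only [Function.comp, id]
  rw [mul_pow]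
  field_simp
  ring

end Good
end MoE

end

/-! ### Choice of the constants and conclusion -/

set_option maxHeartbeats 2000000 in
theorem theorem1
    (L : ℕ) (K A π₀ C₂ cn E p₀ cu cp ν : ℝ)
    (hπ₀ : 0 < π₀) (hp₀ : 0 < p₀) (hcp : 0 < cp) (hν : 0 < ν) :
    ∃ ηmax > (0 : ℝ), ∀ ηmin > (0 : ℝ), ∃ τmin > (0 : ℝ),
    ∀ (τmax β : ℝ) (N : ℕ), 0 < β → ∃ d₀ : ℕ,
    ∀ (d n m k l B T : ℕ), d₀ ≤ d → 0 < m → 2 ≤ l → l ≤ L → l ≤ n →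
      (n : ℝ) ≤ cn * d → (k : ℝ) ≤ K * Real.sqrt d →
    ∀ (ηe ηr : ℝ), 0 < ηe → ηe ≤ E →
      ηmin * (ηe / (m * d * l ^ 2)) ≤ ηr → ηr ≤ ηmax * (ηe / (m * d * l ^ 2)) →
      β * (l ^ 2 * d ^ 2) ≤ (B : ℝ) →
      τmin * (l ^ 2 * Real.sqrt (d * Real.log l) / ηe) ≤ (T : ℝ) →
      (T : ℝ) ≤ τmax * (l ^ 2 * Real.sqrt (d * Real.log l) / ηe) →
    ∀ (sel : (Fin n → ℝ) → Finset (Fin n)), MoE.IsTopSelector n l sel →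
    ∀ (P : Fin d → MoE.Vec d), Orthonormal ℝ P →
    ∀ (o : ℤˣ → Fin d), Function.Injective o →
    ∀ (D : Measure (MoE.Sample n d)), MoE.IsDataModel o A π₀ D →
    ∀ (a : Fin k → ℤˣ) (θ₀ : MoE.Weights d m k),
      MoE.IsPretrained sel P o l D a C₂ p₀ cp ν θ₀ →
    ∀ (γ : ℝ),
      (∀ c : ℤˣ, γ * ((MoE.headSet a c).card : ℝ) ≤
        (((MoE.headSet a c).filter fun s =>
          MoE.proficiency sel P o l D θ₀ c s ≤ cu / d).card : ℝ)) →
    ∀ {Ω : Type*} [MeasurableSpace Ω] (μ : Measure Ω) [IsProbabilityMeasure μ]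
      (Z : ℕ → Fin B → Ω → MoE.Sample n d),
      (∀ t b, HasLaw (Z t b) D μ) →
      iIndepFun (fun i : ℕ × Fin B => Z i.1 i.2) μ →
    μ {ω | ¬ ∀ (ρ : ℝ), 0 ≤ ρ → ρ < 1 → ρ ≤ γ → ∀ (R : Finset (Fin k)),
        MoE.IsRetained a
          (MoE.normChange θ₀ (MoE.sgd sel P a ηe ηr (fun t b => Z t b ω) θ₀ T)) ρ R →
        D {z | 0 < MoE.sgn z.2 * MoE.output sel a
          (MoE.sgd sel P a ηe ηr (fun t b => Z t b ω) θ₀ T) R (MoE.tokens P z)} = 1}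
      ≤ ENNReal.ofReal (1 / (d : ℝ) ^ N) := by
  -- For `L < 2` no `l` satisfies `2 ≤ l ≤ L`.
  by_cases hL : 2 ≤ L
  swap
  · refine ⟨1, one_pos, fun _ _ => ⟨1, one_pos, fun _ _ _ _ => ⟨0, ?_⟩⟩⟩
    intro d n m k l B T _ _ h2 hlL
    omega
  have hL0 : (0 : ℝ) < L := by exact_mod_cast (by omega : 0 < L)
  obtain ⟨C, hC⟩ : ∃ C, C = |C₂| + 1 := ⟨_, rfl⟩
  obtain ⟨E', hE'⟩ : ∃ E', E' = |E| + 1 := ⟨_, rfl⟩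
  obtain ⟨A', hA'⟩ : ∃ A', A' = |A| + 1 := ⟨_, rfl⟩
  obtain ⟨κ, hκ⟩ : ∃ κ, κ = π₀ * p₀ / 2 := ⟨_, rfl⟩
  obtain ⟨Λ, hΛ⟩ : ∃ Λ, Λ = Real.log L / 2 := ⟨_, rfl⟩
  obtain ⟨g, hg⟩ : ∃ g, g = 1 / (L * Real.exp (2 * Λ + 1)) := ⟨_, rfl⟩
  obtain ⟨β₁, hβ₁⟩ : ∃ β₁, β₁ = ν * g * κ / 6 := ⟨_, rfl⟩
  have hC1 : 1 ≤ C := by rw [hC]; linarith [abs_nonneg C₂]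
  have hA1 : 1 ≤ A' := by rw [hA']; linarith [abs_nonneg A]
  have hE0 : 0 < E' := by rw [hE']; positivity
  have hκ0 : 0 < κ := by rw [hκ]; positivity
  have hg0 : 0 < g := by rw [hg]; positivity
  have hβ₁0 : 0 < β₁ := by rw [hβ₁]; positivity
  have hC0 : 0 < C := by linarith
  -- Largest rate for which the early loss of the router stays below a quarter of the separation `cp
  -- / d`.
  obtain ⟨ηmax, hηmax⟩ : ∃ ηmax, ηmax = cp / (4 * C * (C / (ν * g * κ) + E')) := ⟨_, rfl⟩
  have hηmax0 : 0 < ηmax := by rw [hηmax]; positivity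
  refine ⟨ηmax, hηmax0, fun ηmin hηmin => ?_⟩
  obtain ⟨c₂, hc₂⟩ : ∃ c₂, c₂ = Real.exp (-(Λ + 1)) * g ^ 2 * κ := ⟨_, rfl⟩
  have hc₂0 : 0 < c₂ := by rw [hc₂]; positivity
  obtain ⟨Q, hQ⟩ : ∃ Q, Q = 4 * L ^ 2 * Real.exp (3 * Λ + 3) := ⟨_, rfl⟩
  have hQ0 : 0 < Q := by rw [hQ]; positivity
  -- The last three summands ensure, in turn, that the neurons overtake `C`, that the router ranks
  -- its pattern first, and that the survivor outweighs all other experts.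
  obtain ⟨τ₁, hτ₁⟩ : ∃ τ₁, τ₁ = 1 + C / β₁ + Q / (ηmin * β₁ * c₂) +
    2 * Q * C * |K| / (β₁ * c₂) := ⟨_, rfl⟩
  have hq1 : 0 < C / β₁ := by positivity
  have hq2 : 0 < Q / (ηmin * β₁ * c₂) := by positivity
  have hq3 : 0 ≤ 2 * Q * C * |K| / (β₁ * c₂) := by positivity
  have hτ₁1 : 1 ≤ τ₁ := by linarith
  refine ⟨τ₁, by linarith, fun τmax β N hβ => ?_⟩
  obtain ⟨τ₂, hτ₂⟩ : ∃ τ₂, τ₂ = |τmax| * (L ^ 2 * Real.sqrt (Real.log L)) := ⟨_, rfl⟩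
  have hτ₂0 : 0 ≤ τ₂ := by rw [hτ₂]; positivity
  obtain ⟨ζ, hζ⟩ : ∃ ζ, ζ = min (2 * β / E') (2 * β * κ ^ 2) := ⟨_, rfl⟩
  have hζ0 : 0 < ζ := by rw [hζ]; exact lt_min (by positivity) (by positivity)
  obtain ⟨Y, hY⟩ := MoE.exists_poly_mul_exp_le (1 + 3 * |K|) ζ hζ0 N
  -- The sum of all lower bounds required of `√d`; the last summand makes `cu / d < p₀`, so that
  -- experts of proficiency `O(1/d)` are not important.
  obtain ⟨D₁, hD₁⟩ : ∃ D₁, D₁ = 1 + 2 * A' * τ₂ + 8 * ηmax * C * A' * τ₂ / cp +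
    4 * ηmax * A' * (C + τ₂) * τ₂ + 2 * ηmax * C * τ₂ + ηmax * E' * (C + τ₂) + cp +
    (C / (ν * g * κ) + E') + 2 * E' + |Y| + |cu| / p₀ := ⟨_, rfl⟩
  have ht1 : 0 ≤ 2 * A' * τ₂ := by positivity
  have ht2 : 0 ≤ 8 * ηmax * C * A' * τ₂ / cp := by positivity
  have ht3 : 0 ≤ 4 * ηmax * A' * (C + τ₂) * τ₂ := by positivity
  have ht4 : 0 ≤ 2 * ηmax * C * τ₂ := by positivity
  have ht5 : 0 ≤ ηmax * E' * (C + τ₂) := by positivity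
  have ht6 : 0 ≤ C / (ν * g * κ) := by positivity
  have ht7 : 0 ≤ |cu| / p₀ := by positivity
  have ht8 := abs_nonneg Y
  refine ⟨⌈D₁ ^ 2⌉₊, ?_⟩
  intro d n m k l B T hd hm hl hlL _ _ hk ηe ηr hηe hηeE hηr1 hηr2 hBβ hT1 hT2 sel hsel P hP o ho
    D hD a θ₀ hθ γ hγ Ω _ μ _ Z hZ hind
  have := hD.isProb
  obtain ⟨y, hy⟩ : ∃ y, y = Real.sqrt d := ⟨_, rfl⟩
  have hDy : D₁ ≤ y := by
    rw [hy]
    exact (le_abs_self _).trans (Real.abs_le_sqrt (Nat.ceil_le.1 hd))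
  have hy1 : 1 ≤ y := by linarith
  have hy0 : 0 < y := by linarith
  have hdy : (d : ℝ) = y ^ 2 := by rw [hy, Real.sq_sqrt (by positivity)]
  have hyd : y ≤ d := by rw [hdy]; exact le_self_pow₀ hy1 two_ne_zero
  have hd0 : (0 : ℝ) < d := by linarith
  have hl0 : (0 : ℝ) < l := by exact_mod_cast (by omega : 0 < l)
  have hl2 : (2 : ℝ) ≤ l := by exact_mod_cast hl
  have hlL' : (l : ℝ) ≤ L := by exact_mod_cast hlL
  have hm0 : (0 : ℝ) < m := by exact_mod_cast hm
  have hlog : Real.log l ≤ Real.log L := Real.log_le_log hl0 hlL'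
  have hlog0 : 1 / 4 ≤ Real.log l := by
    have h1 := Real.log_le_log two_pos hl2
    have h2 := Real.log_two_gt_d9
    linarith
  have hηeE' : ηe ≤ E' := by rw [hE']; linarith [le_abs_self E]
  obtain ⟨x, hx⟩ : ∃ x, x = ηe * T := ⟨_, rfl⟩
  have hsqrt : Real.sqrt (d * Real.log l) = y * Real.sqrt (Real.log l) := by
    rw [Real.sqrt_mul hd0.le, hy]
  rw [hsqrt] at hT1 hT2
  have hsq1 : 1 ≤ l ^ 2 * Real.sqrt (Real.log l) := by
    have h1 : 1 / 2 ≤ Real.sqrt (Real.log l) := Real.le_sqrt_of_sq_le (by linarith)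
    have h2 : (2 : ℝ) ^ 2 ≤ (l : ℝ) ^ 2 := by gcongr
    calc (1 : ℝ) ≤ 2 ^ 2 * (1 / 2) := by norm_num
      _ ≤ _ := by gcongr
  have hx1 : τ₁ * y ≤ x := by
    calc τ₁ * y ≤ τ₁ * y * (l ^ 2 * Real.sqrt (Real.log l)) :=
          le_mul_of_one_le_right (by positivity) hsq1
      _ = ηe * (τ₁ * (l ^ 2 * (y * Real.sqrt (Real.log l)) / ηe)) := by field_simp
      _ ≤ x := by rw [hx]; gcongr
  have hx2 : x ≤ τ₂ * y := by
    calc x ≤ ηe * (τmax * (l ^ 2 * (y * Real.sqrt (Real.log l)) / ηe)) := by rw [hx]; gcongr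
      _ = τmax * (l ^ 2 * Real.sqrt (Real.log l)) * y := by field_simp
      _ ≤ |τmax| * (L ^ 2 * Real.sqrt (Real.log L)) * y := by
          gcongr
          exact le_abs_self _
      _ = τ₂ * y := by rw [hτ₂]
  have hr1 : ηr * m ≤ ηmax * ηe / d := by
    calc ηr * m ≤ ηmax * (ηe / (m * d * l ^ 2)) * m := by gcongr
      _ = ηmax * ηe / (d * l ^ 2) := by field_simp
      _ ≤ ηmax * ηe / d := by
          gcongr
          exact le_mul_of_one_le_right hd0.le (one_le_pow₀ (by linarith))
  have hr2 : ηmin * ηe / (d * L ^ 2) ≤ ηr * m := by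
    calc ηmin * ηe / (d * L ^ 2) ≤ ηmin * ηe / (d * l ^ 2) := by gcongr
      _ = ηmin * (ηe / (m * d * l ^ 2)) * m := by field_simp
      _ ≤ ηr * m := by gcongr
  have hk' : (k : ℝ) ≤ |K| * y := by
    rw [← hy] at hk
    exact hk.trans (by gcongr; exact le_abs_self K)
  have hadm := MoE.isAdmissible_of_large (k := k) hC1 hA1 hκ0 hν hcp hl hlL hm hηe hηeE' hηmax0
    hηmin hτ₂0 hg hβ₁ (by rw [hηmax, div_mul_cancel₀ _ (by positivity)]) hx hy hy1 hx1 hx2 hr1 hr2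
    hk' hτ₁1
    (by
      rw [← div_le_iff₀' hβ₁0]
      linarith)
    (by
      rw [← hc₂, ← hQ, ← div_lt_iff₀' (by positivity)]
      linarith)
    (by
      rw [← hc₂, show 8 * (L : ℝ) ^ 2 * Real.exp (3 * Λ + 3) * C * |K| = 2 * Q * C * |K| by
        rw [hQ]; ring, ← div_lt_iff₀' (by positivity)]
      linarith)
    (by linarith)
    (by
      rw [← div_le_iff₀' hcp]
      linarith)
    (by linarith) (by linarith) (by linarith) (by linarith) (by linarith) (by linarith)
  have hxy : y ≤ x := (le_mul_of_one_le_left hy0.le hτ₁1).trans hx1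
  have hTE : y / E' ≤ T := by
    rw [div_le_iff₀ hE0]
    calc y ≤ ηe * T := hx ▸ hxy
      _ ≤ T * E' := by
          rw [mul_comm]
          gcongr
  have hT : 2 ≤ T := by
    have : 2 ≤ y / E' := by
      rw [le_div_iff₀ hE0]
      linarith
    exact_mod_cast this.trans hTE
  have hBd : β * d ^ 2 ≤ B := by
    refine le_trans ?_ hBβ
    gcongr
    exact le_mul_of_one_le_left (by positivity) (one_le_pow₀ (by linarith))
  have hB : 0 < B := by
    have : (0 : ℝ) < B := lt_of_lt_of_le (by positivity) hBd
    exact_mod_cast this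
  have hprob := MoE.measure_not_areGoodBatches_le (sel := sel) (P := P) (a := a) (θ₀ := θ₀) (l := l)
    (A' := A') hD hπ₀ hp₀ (by rw [hA']; linarith [le_abs_self A]) hA1 μ hB hZ hind
    (S₀ := ⌈C / (ν * g * κ) / ηe⌉₊) (S₁ := T / 2) (T := T) (X := ζ * y)
    (Nat.ceil_pos.2 (by positivity)) (by omega) (by omega)
    (by
      calc ζ * y ≤ 2 * β / E' * y := by
            gcongr
            rw [hζ]
            exact min_le_left _ _
        _ = 2 * β * (y / E') := by ring
        _ ≤ 2 * β * T := by gcongr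
        _ ≤ 2 * β * T * A' ^ 2 := le_mul_of_one_le_right (by positivity) (one_le_pow₀ hA1)
        _ = 2 * (T * (β * d ^ 2)) * (A' / d) ^ 2 := by field_simp
        _ ≤ 2 * (T * B) * (A' / d) ^ 2 := by gcongr)
    (by
      calc ζ * y ≤ 2 * β * κ ^ 2 * d ^ 2 := by
            have h1 : y ≤ (d : ℝ) ^ 2 := hyd.trans (le_self_pow₀ (hy1.trans hyd) two_ne_zero)
            gcongr
            rw [hζ]
            exact min_le_right _ _
        _ = 2 * (β * d ^ 2) * κ ^ 2 := by ring
        _ ≤ 2 * B * (π₀ * p₀ / 2) ^ 2 := by rw [← hκ]; gcongr)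
  refine le_trans (measure_mono ?_) (hprob.trans (ENNReal.ofReal_le_ofReal ?_))
  · intro ω hω hgood
    refine hω fun ρ hρ0 _ hργ R hR => ?_
    rw [← hκ] at hgood
    refine (mem_ae_iff_prob_eq_one .of_discrete).1 ?_
    filter_upwards [hD.task_specific] with z hz
    refine hgood.output_pruned_pos hadm hsel hP ho hB
      (fun s => (hθ.router_norm s).trans (by rw [hΛ]; linarith))
      (fun s r => (hθ.neuron_norm s r).trans (by rw [hC]; linarith [le_abs_self C₂]))
      (fun c => ?_) (fun s hs q hq => ?_) (fun s hs => ?_)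
      (fun c => (MoE.headSet a c).filter fun s => MoE.proficiency sel P o l D θ₀ c s ≤ cu / d)
      (fun c => Finset.filter_subset _ _) (fun c s hs hsI => ?_) (fun c => ?_) hR hz
    · obtain ⟨s, hs, hp⟩ := hθ.exists_important c
      have hc := (Finset.mem_filter.1 hs).2
      exact ⟨s, by rwa [Set.mem_ofPred_eq, hc], hc⟩
    · have := hθ.separated (a s) s (Finset.mem_filter.2 ⟨Finset.mem_univ _, rfl⟩) hs q hq
      refine le_trans (le_of_eq ?_) this
      field_simp
    · exact hθ.activated (a s) s (Finset.mem_filter.2 ⟨Finset.mem_univ _, rfl⟩) hs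
    · obtain ⟨hs1, hs2⟩ := Finset.mem_filter.1 hs
      have hc := (Finset.mem_filter.1 hs1).2
      rw [Set.mem_ofPred_eq, hc] at hsI
      have h1 : |cu| / p₀ < d := by linarith
      rw [div_lt_iff₀ hp₀] at h1
      have h2 : cu / d < p₀ := by
        rw [div_lt_iff₀ hd0]
        linarith [le_abs_self cu]
      linarith
    · exact (mul_le_mul_of_nonneg_right hργ (Nat.cast_nonneg _)).trans (hγ c)
  · rw [hdy]
    refine le_trans ?_ (hY y (by linarith [le_abs_self Y]))
    gcongr
    have : |K| * y ≤ |K| * y ^ 2 := by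
      gcongr
      exact le_self_pow₀ hy1 two_ne_zero
    linarith
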